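/- Let $q\in\mathbb C$ with $0<|q|<1$. For $k\in\mathbb N=\{0,1,2,\dots\}$ put $(a)_k=\prod_{j=0}^{k-1}(1-aq^j)$ and $(a_1,\dots,a_r)_k=(a_1)_k\cdots(a_r)_k$, and let $${}_{n+1}W_n[a_0;a_3,\dots,a_n;q;u]=\sum_{k\in\mathbb N}\frac{1-a_0q^{2k}}{1-a_0}\,\frac{(a_0,a_3,\dots,a_n)_k}{(q,a_0q/a_3,\dots,a_0q/a_n)_k}\,u^k$$ be the very well-poised basic hypergeometric series. Let $N\in\mathbb N$ and let $t,\sigma,b,c,d_1,d_2,e,f,\beta,\delta_1,\delta_2,\phi$ be nonzero complex numbers satisfying $$t^3\sigma^2q^{N+3}=bcd_1d_2ef\,\beta\delta_1\delta_2\phi .$$ Assume that no denominator occurring below vanishes, that is, $(x)_N\neq0$ for each $x$ among $$\tfrac bt,\ \tfrac ct,\ \tfrac{d_1}t,\ \tfrac{d_2}t,\ \tfrac qe,\ \tfrac qf,\ tq,\ \tfrac{tq}e,\ \tfrac{tq}f,\ \tfrac{tq}{bf},\ \tfrac{tq}{cf},\ \tfrac{tq}{d_1f},\ \tfrac{tq}{d_2f},\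 \tfrac{fq}e,\ \tfrac{\sigma q}\beta,\ \tfrac{\sigma q}{\delta_1},\ \tfrac{\sigma q}{\delta_2},\ \tfrac{\sigma q}\phi,\ \tfrac{\sigma q}{\beta\phi},\ \tfrac{\sigma q}{\delta_1\phi},\ \tfrac{\sigma q}{\delta_2\phi},$$ and $(1/t)_{N+1}\ne0$, $(e/f)_{N+1}\neq0$, $(\sigma)_{2N+1}\neq0$. Then $$\sum_{K\in\mathbb N}\frac{(b/t,\,c/t,\,d_1/t,\,d_2/t,\,\sigma q,\,\phi,\,q^{-N})_K}{(q,\,1/t,\,q/e,\,q/f,\,\sigma q/\beta,\,\sigma q/\delta_1,\,\sigma q/\delta_2)_K}\,q^K$$ $$\times\ {}_{10}W_9\Big[tq^{-K};\,b,c,d_1,d_2,eq^{-K},fq^{-K},q^{-K};\,q;\,\frac{t^3q^3}{bcd_1d_2ef}\Big]\ {}_8W_7\Big[\sigma q^K;\,\beta,\delta_1,\delta_2,\phi q^K,q^{K-N};\,q;\,\frac{\sigma^2q^{N+2}}{\beta\delta_1\delta_2\phi}\Big]$$ $$=\ \phi^N\,\frac{(\sigma q,\ \sigma q/\beta\phi,\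 \sigma q/\delta_1\phi,\ \sigma q/\delta_2\phi)_N}{(\sigma q/\beta,\ \sigma q/\phi,\ \sigma q/\delta_1,\ \sigma q/\delta_2)_N}$$ $$\times\sum_{L\in\mathbb N}\frac{(tq/bf,\ tq/cf,\ tq/d_1f,\ tq/d_2f,\ q^{-N}\phi/\sigma,\ \phi,\ q^{-N})_L}{(q,\ e/f,\ tq/f,\ q/f,\ q^{-N}\phi\beta/\sigma,\ q^{-N}\delta_1\phi/\sigma,\ q^{-N}\delta_2\phi/\sigma)_L}\,q^L$$ $$\times\ {}_{10}W_9\Big[\frac{fq^{-L}}e;\ \frac{tq}{ce},\frac{tq}{be},\frac{tq}{d_1e},\frac{tq}{d_2e},\frac{fq^{-L}}t,fq^{-L},q^{-L};\,q;\,\frac{bcd_1d_2ef\,q^{-1}}{t^3}\Big].$$ Because of the factor $(q^{-N})_K$ (resp. $(q^{-N})_L$), the terms with $K>N$ (resp. $L>N$) are read as $0$; all the $W$-series in the remaining terms terminate. -/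

import Mathlib

noncomputable section

/-- The `q`-shifted factorial `(a; q)_k = (1 - a) (1 - a q) ⋯ (1 - a q^(k-1))` for `k ∈ ℕ`. -/
def qPoch (q a : ℂ) (k : ℕ) : ℂ :=
  ∏ j ∈ Finset.range k, (1 - a * q ^ j)

/-- The product `(a₁, …, a_r; q)_k = (a₁; q)_k ⋯ (a_r; q)_k`. -/
def qPochs (q : ℂ) (l : List ℂ) (k : ℕ) : ℂ :=
  (l.map fun a => qPoch q a k).prod

/-- The very well-poised series `_{n+1}W_n [a₀; a₃, …, a_n; q; u]`, where `l = [a₃, …, a_n]`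
(so `l` has length `7` for a `₁₀W₉` and length `5` for an `₈W₇`):
`∑_k (1 - a₀ q^(2k)) / (1 - a₀) * (a₀, a₃, …, a_n)_k / (q, a₀ q / a₃, …, a₀ q / a_n)_k * u^k`. -/
def vwpSeries (q a₀ : ℂ) (l : List ℂ) (u : ℂ) : ℂ :=
  ∑' k : ℕ, (1 - a₀ * q ^ (2 * k)) / (1 - a₀) *
    (qPochs q (a₀ :: l) k / qPochs q (q :: l.map fun a => a₀ * q / a) k) * u ^ k

end

open Finset Filter Topology

/-! Reversing shifted factorials turns the left ₁₀W₉ with its prefactor into a double sum $s_K$ over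
$i+k=K$ (`a2Sum`). Everything rests on an Euler transformation for the generating function of these
sums, $\sum_K s_K u^K=\frac{(Au)_\infty}{(u)_\infty}\sum_L \tilde s_L u^L$ (`euler_transformation`,
read coefficientwise). Here $A$ is `eulerArg`, and $\tilde s_L$ is $A^L$ times the same kind of
double sum with $(t,e,f)$ replaced by $(f/e,f/t,f)$ and each numerator parameter $x$ by $tq/(xe)$.

The Euler transformation is proved by uniqueness. In degree $K$ both sides are symmetric in the four
numerator parameters, polynomial of degree at most $K$ in each, and satisfy the same $q$-difference
relation in $(b,c)$: termwise for the original series, by telescoping for the dual one. By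
`eq_zero_of_contiguous` a solution vanishes if for each $b=q^{-n}$, $n\le K$, it vanishes at one
further suitable $c$. Such values come from $d=tq/e$, $d'=tq/f$, where both sides collapse to one
term; symmetry then frees $d$ and $d'$ one at a time.

Setting one parameter to $tq/e$ degenerates the Euler transformation to Watson's transformation. It
expands the ₈W₇ in the $K$-th summand as $A'^K\sum_j \frac{(A')_j}{(q)_j}G(K+j)$ up to a constant,
with $G$ depending on $K+j$ only. Balancing says exactly $A'=A^{-1}$. After exchanging sums, the
coefficient of $G(l)$ is $\sum_{j+K=l}\frac{(A^{-1})_j}{(q)_j}A^{-K}s_K$, which by the Euler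
transformation started from the dual side is the dual double sum of degree $l$, that is, the
right-hand ₁₀W₉ with its prefactor. -/

/-! ### Shifted factorials -/

theorem qPoch_zero (q a : ℂ) : qPoch q a 0 = 1 := by simp [qPoch]

theorem qPoch_succ (q a : ℂ) (k : ℕ) : qPoch q a (k + 1) = qPoch q a k * (1 - a * q ^ k) := by
  simp [qPoch, Finset.prod_range_succ]

theorem qPoch_succ' (q a : ℂ) (k : ℕ) : qPoch q a (k + 1) = (1 - a) * qPoch q (a * q) k := by
  simp only [qPoch, Finset.prod_range_succ']
  rw [mul_comm]
  congr 1
  · simp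
  · exact Finset.prod_congr rfl fun j _ => by ring

theorem qPoch_ne_zero_iff {q a : ℂ} {k : ℕ} : qPoch q a k ≠ 0 ↔ ∀ j < k, 1 - a * q ^ j ≠ 0 := by
  simp [qPoch, Finset.prod_ne_zero_iff]

theorem qPoch_ne_zero_mono {q a : ℂ} {k l : ℕ} (h : qPoch q a l ≠ 0) (hkl : k ≤ l) :
    qPoch q a k ≠ 0 :=
  qPoch_ne_zero_iff.2 fun j hj => qPoch_ne_zero_iff.1 h j (hj.trans_le hkl)

/-! ### The double series, its dual and the Euler sum -/

/-- The weight of the two-dimensional `A`-type series attached to `t, e, f`. -/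
noncomputable def a2Weight (q t e f : ℂ) (i k : ℕ) : ℂ :=
  (q ^ i - t * q ^ k) / (1 - t) /
    (qPoch q q i * qPoch q (q / t) i * qPoch q (q / e) i * qPoch q (q / f) i *
      (qPoch q q k * qPoch q (t * q) k * qPoch q (t * q / e) k * qPoch q (t * q / f) k))

/-- The numerator factor of the two-dimensional series belonging to one parameter. -/
noncomputable def a2Num (q t x : ℂ) (i k : ℕ) : ℂ := qPoch q (x / t) i * qPoch q x k

/-- The homogeneous part of degree `K` of the two-dimensional `A`-type series. -/
noncomputable def a2Sum (q t e f b c d d' : ℂ) (K : ℕ) : ℂ :=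
  ∑ p ∈ antidiagonal K, a2Weight q t e f p.1 p.2 *
    (a2Num q t b p.1 p.2 * a2Num q t c p.1 p.2 * a2Num q t d p.1 p.2 * a2Num q t d' p.1 p.2)

/-- The numerator factor of the dual series, as a polynomial in the parameter. -/
noncomputable def dualNum (q t e f x : ℂ) (i k : ℕ) : ℂ :=
  (∏ j ∈ range i, (x - t * q ^ (j + 1) / f)) * ∏ j ∈ range k, (x - t * q ^ (j + 1) / e)

/-- The homogeneous part of degree `L` of the dual series. -/
noncomputable def dualSum (q t e f b c d d' : ℂ) (L : ℕ) : ℂ :=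
  (e * f / (t ^ 3 * q ^ 2)) ^ L * ∑ p ∈ antidiagonal L, a2Weight q (f / e) (f / t) f p.1 p.2 *
    (dualNum q t e f b p.1 p.2 * dualNum q t e f c p.1 p.2 * dualNum q t e f d p.1 p.2 *
      dualNum q t e f d' p.1 p.2)

/-- The quantity `b c d d' e f / (t ^ 3 q ^ 2)` governing the Euler transformation. -/
noncomputable def eulerArg (q t e f b c d d' : ℂ) : ℂ := b * c * d * d' * (e * f / (t ^ 3 * q ^ 2))

/-- The coefficients of the ratio of infinite products `(A u; q)_∞ / (u; q)_∞`. -/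
noncomputable def binomCoeff (q A : ℂ) (M : ℕ) : ℂ := qPoch q A M / qPoch q q M

/-- The homogeneous part of degree `K` of the right-hand side of the Euler transformation. -/
noncomputable def eulerSum (q t e f b c d d' : ℂ) (K : ℕ) : ℂ :=
  ∑ p ∈ antidiagonal K, binomCoeff q (eulerArg q t e f b c d d') p.1 *
    dualSum q t e f b c d d' p.2

/-- No denominator of the series up to degree `K` vanishes. -/
structure A2Regular (q t e f : ℂ) (K : ℕ) : Prop where
  q_ne : q ≠ 0
  t_ne : t ≠ 0
  e_ne : e ≠ 0
  f_ne : f ≠ 0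
  qq : qPoch q q K ≠ 0
  -- Length $K+1$: the factor $j=0$ gives $t\ne1$, the others give $(q/t)_K\ne0$. The condition `ef`
  -- plays the same role for the dual series.
  inv_t : qPoch q (1 / t) (K + 1) ≠ 0
  tq : qPoch q (t * q) K ≠ 0
  ef : qPoch q (e / f) (K + 1) ≠ 0
  fe : qPoch q (f * q / e) K ≠ 0
  qe : qPoch q (q / e) K ≠ 0
  qf : qPoch q (q / f) K ≠ 0
  te : qPoch q (t * q / e) K ≠ 0
  tf : qPoch q (t * q / f) K ≠ 0

theorem A2Regular.mono {q t e f : ℂ} {K L : ℕ} (h : A2Regular q t e f K) (hLK : L ≤ K) :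
    A2Regular q t e f L :=
  ⟨h.q_ne, h.t_ne, h.e_ne, h.f_ne, qPoch_ne_zero_mono h.qq hLK,
    qPoch_ne_zero_mono h.inv_t (by omega), qPoch_ne_zero_mono h.tq hLK,
    qPoch_ne_zero_mono h.ef (by omega), qPoch_ne_zero_mono h.fe hLK,
    qPoch_ne_zero_mono h.qe hLK, qPoch_ne_zero_mono h.qf hLK,
    qPoch_ne_zero_mono h.te hLK, qPoch_ne_zero_mono h.tf hLK⟩

theorem A2Regular.one_sub_t_ne {q t e f : ℂ} {K : ℕ} (h : A2Regular q t e f K) : 1 - t ≠ 0 := by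
  have := qPoch_ne_zero_iff.1 h.inv_t 0 (by omega)
  intro h1
  have : t = 1 := by linear_combination -h1
  simp_all

theorem A2Regular.e_ne_f {q t e f : ℂ} {K : ℕ} (h : A2Regular q t e f K) : e ≠ f := by
  have := qPoch_ne_zero_iff.1 h.ef 0 (by omega)
  rintro rfl
  simp [h.e_ne] at this

/-! ### Contiguous relation of the original series -/

theorem a2Num_mul_q (q t x : ℂ) (i k : ℕ) :
    (1 - x) * (1 - x / t) * a2Num q t (x * q) i k =
      (1 - x * q ^ k) * (1 - x / t * q ^ i) * a2Num q t x i k := by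
  have h1 := (qPoch_succ' q x k).symm.trans (qPoch_succ q x k)
  have h2 := (qPoch_succ' q (x / t) i).symm.trans (qPoch_succ q (x / t) i)
  rw [show x / t * q = x * q / t by ring] at h2
  unfold a2Num
  linear_combination (1 - x / t) * qPoch q (x * q / t) i * h1 +
    qPoch q x k * (1 - x * q ^ k) * h2

/-- This holds term by term: $c(1-bq^k)(1-bq^i/t)-b(1-cq^k)(1-cq^i/t)=(c-b)(1-bcq^{i+k}/t)$ depends
on $i+k$ only. -/
theorem a2Sum_contiguous (q t e f b c d d' : ℂ) (K : ℕ) :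
    c * ((1 - b) * (1 - b / t)) * a2Sum q t e f (b * q) c d d' K -
      b * ((1 - c) * (1 - c / t)) * a2Sum q t e f b (c * q) d d' K =
      (c - b) * (1 - b * c * q ^ K / t) * a2Sum q t e f b c d d' K := by
  simp only [a2Sum, Finset.mul_sum, ← Finset.sum_sub_distrib]
  refine Finset.sum_congr rfl fun p hp => ?_
  rw [← mem_antidiagonal.1 hp]
  generalize p.1 = i
  generalize p.2 = k
  have hb := a2Num_mul_q q t b i k
  have hc := a2Num_mul_q q t c i k
  rw [pow_add]
  linear_combination
    c * a2Weight q t e f i k * a2Num q t c i k * a2Num q t d i k * a2Num q t d' i k * hb -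
    b * a2Weight q t e f i k * a2Num q t b i k * a2Num q t d i k * a2Num q t d' i k * hc

/-! ### Contiguous relation of the dual series, by telescoping -/

theorem dualNum_mul_q (q t e f x : ℂ) (i k : ℕ) :
    dualNum q t e f (x * q) i k = q ^ (i + k) *
      ((∏ j ∈ range i, (x - t * q ^ j / f)) * ∏ j ∈ range k, (x - t * q ^ j / e)) := by
  have h (y : ℂ) (n : ℕ) : ∏ j ∈ range n, (x * q - t * q ^ (j + 1) / y) =
      q ^ n * ∏ j ∈ range n, (x - t * q ^ j / y) := by
    rw [← Finset.card_range n, ← Finset.prod_const, Finset.card_range, ← Finset.prod_mul_distrib]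
    exact Finset.prod_congr rfl fun j _ => by ring
  rw [dualNum, h, h, pow_add]
  ring

theorem prod_shift (x : ℂ) (g : ℕ → ℂ) (i : ℕ) :
    (x - g 0) * ∏ j ∈ range i, (x - g (j + 1)) = (∏ j ∈ range i, (x - g j)) * (x - g i) := by
  rw [← Finset.prod_range_succ, Finset.prod_range_succ', mul_comm]

/-- The denominator of the weight of the dual series. -/
noncomputable def dualDen (q t e f : ℂ) (i k : ℕ) : ℂ :=
  qPoch q q i * qPoch q (q / (f / e)) i * qPoch q (q / (f / t)) i * qPoch q (q / f) i *
    (qPoch q q k * qPoch q (f / e * q) k * qPoch q (f / e * q / (f / t)) k *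
      qPoch q (f / e * q / f) k)

/-- The ratio of consecutive dual denominators. -/
def dualRatio (t e f z : ℂ) : ℂ := (1 - f * z) * (1 - e * z) * (1 - t * z) * (1 - z)

theorem dualDen_ne_zero {q t e f : ℂ} {K : ℕ} (h : A2Regular q t e f K) {i k : ℕ} (hi : i ≤ K)
    (hk : k ≤ K) : dualDen q t e f i k ≠ 0 := by
  have ht := h.t_ne
  have he := h.e_ne
  have hf := h.f_ne
  have h1 : qPoch q (q / (f / e)) i ≠ 0 := by
    rw [qPoch_ne_zero_iff]
    intro j hj
    have := qPoch_ne_zero_iff.1 h.ef (j + 1) (by omega)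
    rwa [show q / (f / e) * q ^ j = e / f * q ^ (j + 1) by field_simp; ring]
  have h2 := qPoch_ne_zero_mono h.tf hi
  have h3 := qPoch_ne_zero_mono h.qf hi
  have h4 := qPoch_ne_zero_mono h.qq hi
  have h5 := qPoch_ne_zero_mono h.qq hk
  have h6 := qPoch_ne_zero_mono h.fe hk
  have h7 := qPoch_ne_zero_mono h.te hk
  have h8 := qPoch_ne_zero_mono h.qe hk
  rw [dualDen, show q / (f / t) = t * q / f by field_simp,
    show f / e * q = f * q / e by ring, show f * q / e / (f / t) = t * q / e by field_simp,
    show f * q / e / f = q / e by field_simp]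
  positivity

theorem dualDen_succ_left {q t e f : ℂ} (ht : t ≠ 0) (he : e ≠ 0) (hf : f ≠ 0) (i k : ℕ) :
    dualDen q t e f (i + 1) k = dualDen q t e f i k * dualRatio t e f (q ^ (i + 1) / f) := by
  have h1 : f * (q ^ (i + 1) / f) = q * q ^ i := by field_simp; ring
  simp only [dualDen, qPoch_succ, dualRatio, h1]
  rw [show q / (f / e) * q ^ i = e * (q ^ (i + 1) / f) by field_simp; ring,
    show q / (f / t) * q ^ i = t * (q ^ (i + 1) / f) by field_simp; ring,
    show q / f * q ^ i = q ^ (i + 1) / f by ring]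
  ring

theorem dualDen_succ_right {q t e f : ℂ} (ht : t ≠ 0) (he : e ≠ 0) (hf : f ≠ 0) (i k : ℕ) :
    dualDen q t e f i (k + 1) = dualDen q t e f i k * dualRatio t e f (q ^ (k + 1) / e) := by
  have h1 : e * (q ^ (k + 1) / e) = q * q ^ k := by field_simp; ring
  simp only [dualDen, qPoch_succ, dualRatio, h1]
  rw [show f / e * q * q ^ k = f * (q ^ (k + 1) / e) by ring,
    show f / e * q / (f / t) * q ^ k = t * (q ^ (k + 1) / e) by field_simp; ring,
    show f / e * q / f * q ^ k = q ^ (k + 1) / e by field_simp; ring]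
  ring

/-- Only the difference of $z=q^i/f$ and $w=q^k/e$ couples the two indices; the rest of the
denominator is a product over $i$ and $k$ separately. -/
theorem a2Weight_dual {q t e f : ℂ} (he : e ≠ 0) (hf : f ≠ 0) (hef : e ≠ f) (i k : ℕ) :
    a2Weight q (f / e) (f / t) f i k =
      (q ^ i / f - q ^ k / e) * (f * e / (e - f)) / dualDen q t e f i k := by
  have h : e - f ≠ 0 := sub_ne_zero.2 hef
  rw [a2Weight, dualDen]
  congr 1
  have h2 : 1 - f / e ≠ 0 := by
    rw [show 1 - f / e = (e - f) / e by field_simp]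
    exact div_ne_zero h he
  rw [div_eq_iff h2]
  field_simp

/-- The algebra behind the telescoping, with $z=q^i/f$ and $w=q^k/e$. Unlike for the original
series, the contiguous relation fails termwise; the error is a difference of two terms exchanged by
$z\leftrightarrow w$. Each carries the `dualRatio` that lowers one index. -/
theorem contiguous_key (b c e f t z w : ℂ) (ht : t ≠ 0) :
    (z - w) * (z * w) * (c * ((1 - b) * (1 - b / t)) * ((b * f - t) * (b * e - t)) *
        ((c - t * z) * (c - t * w)) -
      b * ((1 - c) * (1 - c / t)) * ((c * f - t) * (c * e - t)) * ((b - t * z) * (b - t * w))) =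
    (c - b) * (z - w) * (1 - b * c * (e * f * z * w) / t) * ((b - t * z) * (b - t * w)) *
        ((c - t * z) * (c - t * w)) +
      (c - b) * (b * c) * (dualRatio t e f z * w * ((b - t * w) * (c - t * w)) -
        dualRatio t e f w * z * ((b - t * z) * (c - t * z))) := by
  unfold dualRatio
  field_simp
  ring

/-- The numerator factor of the dual series at `x q`, up to a power of `q`. -/
noncomputable def dualNumQ (q t e f x : ℂ) (i k : ℕ) : ℂ :=
  (∏ j ∈ range i, (x - t * q ^ j / f)) * ∏ j ∈ range k, (x - t * q ^ j / e)

theorem dualNum_eq_dualNumQ (q t e f x : ℂ) (i k : ℕ) :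
    (x - t / f) * (x - t / e) * dualNum q t e f x i k =
      dualNumQ q t e f x i k * ((x - t * (q ^ i / f)) * (x - t * (q ^ k / e))) := by
  have h1 := prod_shift x (fun j => t * q ^ j / f) i
  have h2 := prod_shift x (fun j => t * q ^ j / e) k
  simp only [pow_zero, mul_one] at h1 h2
  unfold dualNum dualNumQ
  linear_combination (x - t / e) * (∏ j ∈ range k, (x - t * q ^ (j + 1) / e)) * h1 +
    (∏ j ∈ range i, (x - t * q ^ j / f)) * (x - t * (q ^ i / f)) * h2

theorem dualNumQ_succ_left (q t e f x : ℂ) (i k : ℕ) :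
    dualNumQ q t e f x (i + 1) k * (x - t * (q ^ k / e)) =
      (x - t / f) * (x - t / e) * dualNum q t e f x i k := by
  rw [dualNum_eq_dualNumQ, dualNumQ, dualNumQ, prod_range_succ]
  ring

theorem dualNumQ_succ_right (q t e f x : ℂ) (i k : ℕ) :
    dualNumQ q t e f x i (k + 1) * (x - t * (q ^ i / f)) =
      (x - t / f) * (x - t / e) * dualNum q t e f x i k := by
  rw [dualNum_eq_dualNumQ, dualNumQ, dualNumQ, prod_range_succ]
  ring

theorem dualNum_succ_left (q t e f x : ℂ) (i k : ℕ) :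
    dualNum q t e f x (i + 1) k = dualNum q t e f x i k * (x - t * (q ^ (i + 1) / f)) := by
  rw [dualNum, dualNum, prod_range_succ]
  ring

theorem dualNum_succ_right (q t e f x : ℂ) (i k : ℕ) :
    dualNum q t e f x i (k + 1) = dualNum q t e f x i k * (x - t * (q ^ (k + 1) / e)) := by
  rw [dualNum, dualNum, prod_range_succ]
  ring

/-- The summand of the contiguous relation of the dual series. -/
noncomputable def contigTerm (q t e f b c d d' : ℂ) (i k : ℕ) : ℂ :=
  a2Weight q (f / e) (f / t) f i k *
    (c * ((1 - b) * (1 - b / t)) * (dualNum q t e f (b * q) i k * dualNum q t e f c i k) -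
      b * ((1 - c) * (1 - c / t)) * (dualNum q t e f b i k * dualNum q t e f (c * q) i k) -
      (c - b) * (1 - b * c * q ^ (i + k) / t) *
        (dualNum q t e f b i k * dualNum q t e f c i k)) *
    (dualNum q t e f d i k * dualNum q t e f d' i k)

/-- The part of the summand that telescopes in the first index. -/
noncomputable def shiftLeft (q t e f b c d d' : ℂ) (i k : ℕ) : ℂ :=
  dualRatio t e f (q ^ i / f) / (q ^ i / f) / dualDen q t e f i k *
    (dualNum q t e f d i k * dualNum q t e f d' i k) *
    (dualNumQ q t e f b i k * (b - t * (q ^ k / e)) / ((b - t / f) * (b - t / e))) *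
    (dualNumQ q t e f c i k * (c - t * (q ^ k / e)) / ((c - t / f) * (c - t / e)))

/-- The part of the summand that telescopes in the second index. -/
noncomputable def shiftRight (q t e f b c d d' : ℂ) (i k : ℕ) : ℂ :=
  dualRatio t e f (q ^ k / e) / (q ^ k / e) / dualDen q t e f i k *
    (dualNum q t e f d i k * dualNum q t e f d' i k) *
    (dualNumQ q t e f b i k * (b - t * (q ^ i / f)) / ((b - t / f) * (b - t / e))) *
    (dualNumQ q t e f c i k * (c - t * (q ^ i / f)) / ((c - t / f) * (c - t / e)))

theorem contigTerm_eq {q t e f b c : ℂ} (hq : q ≠ 0) (ht : t ≠ 0) (he : e ≠ 0) (hf : f ≠ 0)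
    (hef : e ≠ f) (hb : (b - t / f) * (b - t / e) ≠ 0) (hc : (c - t / f) * (c - t / e) ≠ 0)
    (d d' : ℂ) (i k : ℕ) :
    contigTerm q t e f b c d d' i k = (c - b) * (b * c) * q ^ (i + k) / (e - f) *
      (shiftLeft q t e f b c d d' i k - shiftRight q t e f b c d d' i k) := by
  have hef' : e - f ≠ 0 := sub_ne_zero.2 hef
  have hB := dualNum_eq_dualNumQ q t e f b i k
  have hC := dualNum_eq_dualNumQ q t e f c i k
  have hB' := (dualNum_mul_q q t e f b i k)
  have hC' := (dualNum_mul_q q t e f c i k)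
  rw [← dualNumQ] at hB' hC'
  rw [mul_comm, ← eq_div_iff hb] at hB
  rw [mul_comm, ← eq_div_iff hc] at hC
  have hk := contiguous_key b c e f t (q ^ i / f) (q ^ k / e) ht
  have hz : q ^ i / f ≠ 0 := div_ne_zero (pow_ne_zero _ hq) hf
  have hw : q ^ k / e ≠ 0 := div_ne_zero (pow_ne_zero _ hq) he
  have hp : q ^ (i + k) = e * f * (q ^ i / f) * (q ^ k / e) := by field_simp; ring
  have hfb : (b * f - t) * (b * e - t) = e * f * ((b - t / f) * (b - t / e)) := by
    field_simp
  have hfc : (c * f - t) * (c * e - t) = e * f * ((c - t / f) * (c - t / e)) := by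
    field_simp
  rw [hfb, hfc] at hk
  unfold contigTerm shiftLeft shiftRight
  rw [hB', hC', hB, hC, a2Weight_dual he hf hef, hp]
  generalize (b - t / f) * (b - t / e) = Pb at *
  generalize (c - t / f) * (c - t / e) = Pc at *
  generalize dualNumQ q t e f b i k = Nb at *
  generalize dualNumQ q t e f c i k = Nc at *
  generalize dualNum q t e f d i k * dualNum q t e f d' i k = S
  generalize dualDen q t e f i k = V
  generalize dualRatio t e f (q ^ i / f) = H1 at *
  generalize dualRatio t e f (q ^ k / e) = H2 at *
  generalize q ^ i / f = z at *
  generalize q ^ k / e = w at *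
  -- The key identity times everything common to all terms of the summand.
  have := congrArg (fun y => y * (f * e / (e - f)) / V * Nb * Nc * S / (Pb * Pc)) hk
  rw [← sub_eq_zero] at this ⊢
  rw [← this]
  generalize (1 - b * c * (e * f * z * w) / t) = Y at *
  generalize (1 - b) * (1 - b / t) = Yb at *
  generalize (1 - c) * (1 - c / t) = Yc at *
  -- Regularity is not assumed here; for $V=0$ both sides are $0$ because division by zero gives
  -- $0$.
  rcases eq_or_ne V 0 with rfl | hV
  · simp
  field_simp
  ring

theorem shiftLeft_zero {q t e f : ℂ} (hf : f ≠ 0) (b c d d' : ℂ) (k : ℕ) :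
    shiftLeft q t e f b c d d' 0 k = 0 := by
  simp [shiftLeft, dualRatio, hf]

theorem shiftRight_zero {q t e f : ℂ} (he : e ≠ 0) (b c d d' : ℂ) (i : ℕ) :
    shiftRight q t e f b c d d' i 0 = 0 := by
  simp [shiftRight, dualRatio, he]

/-- Raising $i$ multiplies the denominator by the same `dualRatio` that stands in `shiftLeft`, so
the two cancel. The $b$ and $c$ numerators drop back to index $i$, and only $d$ and $d'$ leave an
extra linear factor each. -/
theorem shiftLeft_succ {q t e f b c : ℂ} {K : ℕ} (h : A2Regular q t e f K)
    (hb : (b - t / f) * (b - t / e) ≠ 0) (hc : (c - t / f) * (c - t / e) ≠ 0) (d d' : ℂ) {i k : ℕ}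
    (hi : i + 1 ≤ K) (hk : k ≤ K) :
    shiftLeft q t e f b c d d' (i + 1) k = (dualDen q t e f i k)⁻¹ *
      (dualNum q t e f b i k * dualNum q t e f c i k * dualNum q t e f d i k *
        dualNum q t e f d' i k) *
      ((d - t * (q ^ (i + 1) / f)) * (d' - t * (q ^ (i + 1) / f)) / (q ^ (i + 1) / f)) := by
  have h1 := dualDen_ne_zero h hi hk
  rw [dualDen_succ_left h.t_ne h.e_ne h.f_ne] at h1
  have h2 := left_ne_zero_of_mul h1
  have h3 := right_ne_zero_of_mul h1
  have hz : q ^ (i + 1) / f ≠ 0 := div_ne_zero (pow_ne_zero _ h.q_ne) h.f_ne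
  rw [shiftLeft, dualNumQ_succ_left, dualNumQ_succ_left, mul_div_cancel_left₀ _ hb,
    mul_div_cancel_left₀ _ hc, dualDen_succ_left h.t_ne h.e_ne h.f_ne, dualNum_succ_left,
    dualNum_succ_left]
  generalize q ^ (i + 1) / f = z at *
  field_simp

theorem shiftRight_succ {q t e f b c : ℂ} {K : ℕ} (h : A2Regular q t e f K)
    (hb : (b - t / f) * (b - t / e) ≠ 0) (hc : (c - t / f) * (c - t / e) ≠ 0) (d d' : ℂ) {i k : ℕ}
    (hi : i ≤ K) (hk : k + 1 ≤ K) :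
    shiftRight q t e f b c d d' i (k + 1) = (dualDen q t e f i k)⁻¹ *
      (dualNum q t e f b i k * dualNum q t e f c i k * dualNum q t e f d i k *
        dualNum q t e f d' i k) *
      ((d - t * (q ^ (k + 1) / e)) * (d' - t * (q ^ (k + 1) / e)) / (q ^ (k + 1) / e)) := by
  have h1 := dualDen_ne_zero h hi hk
  rw [dualDen_succ_right h.t_ne h.e_ne h.f_ne] at h1
  have h2 := left_ne_zero_of_mul h1
  have h3 := right_ne_zero_of_mul h1
  have hz : q ^ (k + 1) / e ≠ 0 := div_ne_zero (pow_ne_zero _ h.q_ne) h.e_ne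
  rw [shiftRight, dualNumQ_succ_right, dualNumQ_succ_right, mul_div_cancel_left₀ _ hb,
    mul_div_cancel_left₀ _ hc, dualDen_succ_right h.t_ne h.e_ne h.f_ne, dualNum_succ_right,
    dualNum_succ_right]
  generalize q ^ (k + 1) / e = z at *
  field_simp

/-- The boundary terms vanish, and what remains lives on the antidiagonal of degree $L$. There
$\frac{(d-tz)(d'-tz)}z-\frac{(d-tw)(d'-tw)}w=(z-w)\left(t^2-\frac{dd'}{zw}\right)$ with
$z=q^{i+1}/f$, $w=q^{k+1}/e$: the factor $z-w$ restores the weight, and $zw=q^{L+2}/(ef)$ is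
constant. -/
theorem sum_contigTerm_of_ne {q t e f b c : ℂ} {L : ℕ} (h : A2Regular q t e f (L + 1))
    (hb : (b - t / f) * (b - t / e) ≠ 0) (hc : (c - t / f) * (c - t / e) ≠ 0) (d d' : ℂ) :
    ∑ p ∈ antidiagonal (L + 1), contigTerm q t e f b c d d' p.1 p.2 =
      (c - b) * (b * c) * (q ^ L * (t * q) ^ 2 / (e * f) - d * d') *
        ∑ p ∈ antidiagonal L, a2Weight q (f / e) (f / t) f p.1 p.2 *
          (dualNum q t e f b p.1 p.2 * dualNum q t e f c p.1 p.2 * dualNum q t e f d p.1 p.2 *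
            dualNum q t e f d' p.1 p.2) := by
  have he := h.e_ne
  have hf := h.f_ne
  have hq := h.q_ne
  have hef := sub_ne_zero.2 h.e_ne_f
  have step : ∑ p ∈ antidiagonal (L + 1), contigTerm q t e f b c d d' p.1 p.2 =
      (c - b) * (b * c) * q ^ (L + 1) / (e - f) *
        (∑ p ∈ antidiagonal (L + 1), shiftLeft q t e f b c d d' p.1 p.2 -
          ∑ p ∈ antidiagonal (L + 1), shiftRight q t e f b c d d' p.1 p.2) := by
    rw [← sum_sub_distrib, mul_sum]
    refine sum_congr rfl fun p hp => ?_
    rw [contigTerm_eq hq h.t_ne he hf h.e_ne_f hb hc, mem_antidiagonal.1 hp]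
  rw [step, Nat.sum_antidiagonal_succ, Nat.sum_antidiagonal_succ', shiftLeft_zero hf,
    shiftRight_zero he, zero_add, zero_add, ← sum_sub_distrib, mul_sum, mul_sum]
  refine sum_congr rfl fun p hp => ?_
  have hp' := mem_antidiagonal.1 hp
  generalize p.1 = i at *
  generalize p.2 = k at *
  rw [shiftLeft_succ h hb hc _ _ (by omega) (by omega),
    shiftRight_succ h hb hc _ _ (by omega) (by omega), a2Weight_dual he hf h.e_ne_f]
  generalize dualNum q t e f b i k * dualNum q t e f c i k * dualNum q t e f d i k *
        dualNum q t e f d' i k = S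
  have hV := dualDen_ne_zero h (i := i) (k := k) (by omega) (by omega)
  generalize dualDen q t e f i k = V at *
  rw [← hp']
  field_simp
  ring

theorem dualSum_contiguous_of_ne {q t e f b c : ℂ} {L : ℕ} (h : A2Regular q t e f (L + 1))
    (hb : (b - t / f) * (b - t / e) ≠ 0) (hc : (c - t / f) * (c - t / e) ≠ 0) (d d' : ℂ) :
    c * ((1 - b) * (1 - b / t)) * dualSum q t e f (b * q) c d d' (L + 1) -
      b * ((1 - c) * (1 - c / t)) * dualSum q t e f b (c * q) d d' (L + 1) =
    (c - b) * ((1 - b * c * q ^ (L + 1) / t) * dualSum q t e f b c d d' (L + 1) -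
      (eulerArg q t e f b c d d' - b * c * q ^ L / t) * dualSum q t e f b c d d' L) := by
  have he := h.e_ne
  have hf := h.f_ne
  have hq := h.q_ne
  have ht := h.t_ne
  have key := sum_contigTerm_of_ne h hb hc d d'
  have split : ∑ p ∈ antidiagonal (L + 1), contigTerm q t e f b c d d' p.1 p.2 =
      c * ((1 - b) * (1 - b / t)) * (∑ p ∈ antidiagonal (L + 1),
        a2Weight q (f / e) (f / t) f p.1 p.2 * (dualNum q t e f (b * q) p.1 p.2 *
          dualNum q t e f c p.1 p.2 * dualNum q t e f d p.1 p.2 * dualNum q t e f d' p.1 p.2)) -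
      b * ((1 - c) * (1 - c / t)) * (∑ p ∈ antidiagonal (L + 1),
        a2Weight q (f / e) (f / t) f p.1 p.2 * (dualNum q t e f b p.1 p.2 *
          dualNum q t e f (c * q) p.1 p.2 * dualNum q t e f d p.1 p.2 *
            dualNum q t e f d' p.1 p.2)) -
      (c - b) * (1 - b * c * q ^ (L + 1) / t) * ∑ p ∈ antidiagonal (L + 1),
        a2Weight q (f / e) (f / t) f p.1 p.2 * (dualNum q t e f b p.1 p.2 *
          dualNum q t e f c p.1 p.2 * dualNum q t e f d p.1 p.2 *
            dualNum q t e f d' p.1 p.2) := by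
    simp only [mul_sum, ← sum_sub_distrib]
    refine sum_congr rfl fun p hp => ?_
    rw [contigTerm, mem_antidiagonal.1 hp]
    ring
  rw [split, sub_eq_iff_eq_add] at key
  simp only [dualSum, eulerArg]
  rw [pow_succ (e * f / (t ^ 3 * q ^ 2))]
  -- The power of $\rho$ in `dualSum` is chosen for this: it turns the constant of the telescoped
  -- sum into $1/t$.
  have hρ : e * f / (t ^ 3 * q ^ 2) * (t * q) ^ 2 / (e * f) = 1 / t := by field_simp
  generalize e * f / (t ^ 3 * q ^ 2) = ρ at *
  generalize (∑ p ∈ antidiagonal L, a2Weight q (f / e) (f / t) f p.1 p.2 *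
    (dualNum q t e f b p.1 p.2 * dualNum q t e f c p.1 p.2 * dualNum q t e f d p.1 p.2 *
      dualNum q t e f d' p.1 p.2)) = S at *
  linear_combination ρ ^ (L + 1) * key + (c - b) * ρ ^ L * S * (b * c) * q ^ L * hρ

/-- Both sides are polynomial in $b$ and $c$, so the exclusion of $t/e$ and $t/f$ is removed by
density, first in $b$, then in $c$. -/
theorem dualSum_contiguous {q t e f : ℂ} {L : ℕ} (h : A2Regular q t e f (L + 1))
    (b c d d' : ℂ) :
    c * ((1 - b) * (1 - b / t)) * dualSum q t e f (b * q) c d d' (L + 1) -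
      b * ((1 - c) * (1 - c / t)) * dualSum q t e f b (c * q) d d' (L + 1) =
    (c - b) * ((1 - b * c * q ^ (L + 1) / t) * dualSum q t e f b c d d' (L + 1) -
      (eulerArg q t e f b c d d' - b * c * q ^ L / t) * dualSum q t e f b c d d' L) := by
  have hdense : Dense {x : ℂ | (x - t / f) * (x - t / e) ≠ 0} := by
    refine (dense_univ.sdiff_finite (Set.toFinite {t / f, t / e})).mono fun x hx => ?_
    simpa [sub_eq_zero, not_or] using hx
  have hb (c : ℂ) (hc : (c - t / f) * (c - t / e) ≠ 0) := congrFun (Continuous.ext_on hdense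
    (f := fun b => c * ((1 - b) * (1 - b / t)) * dualSum q t e f (b * q) c d d' (L + 1) -
      b * ((1 - c) * (1 - c / t)) * dualSum q t e f b (c * q) d d' (L + 1))
    (g := fun b => (c - b) * ((1 - b * c * q ^ (L + 1) / t) * dualSum q t e f b c d d' (L + 1) -
      (eulerArg q t e f b c d d' - b * c * q ^ L / t) * dualSum q t e f b c d d' L))
    (by unfold dualSum dualNum; fun_prop) (by unfold dualSum dualNum eulerArg; fun_prop)
    fun b hb => dualSum_contiguous_of_ne h hb hc d d')
  exact congrFun (Continuous.ext_on hdense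
    (f := fun c => c * ((1 - b) * (1 - b / t)) * dualSum q t e f (b * q) c d d' (L + 1) -
      b * ((1 - c) * (1 - c / t)) * dualSum q t e f b (c * q) d d' (L + 1))
    (g := fun c => (c - b) * ((1 - b * c * q ^ (L + 1) / t) * dualSum q t e f b c d d' (L + 1) -
      (eulerArg q t e f b c d d' - b * c * q ^ L / t) * dualSum q t e f b c d d' L))
    (by unfold dualSum dualNum; fun_prop) (by unfold dualSum dualNum eulerArg; fun_prop)
    fun c hc => hb c hc b) c

theorem dualSum_zero {q t e f : ℂ} {K : ℕ} (h : A2Regular q t e f K) (b c d d' : ℂ) :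
    dualSum q t e f b c d d' 0 = 1 := by
  have : 1 - f / e ≠ 0 := by
    rw [show 1 - f / e = (e - f) / e by field_simp [h.e_ne]]
    exact div_ne_zero (sub_ne_zero.2 h.e_ne_f) h.e_ne
  simp [dualSum, dualNum, a2Weight, qPoch_zero, this]

/-! ### Contiguous relation of the Euler sum -/

theorem binomCoeff_zero (q A : ℂ) : binomCoeff q A 0 = 1 := by simp [binomCoeff, qPoch_zero]

/-- Coefficient form of $F_A(u)=(1-Au)F_{Aq}(u)$ for $F_A(u)=(Au)_\infty/(u)_\infty$. -/
theorem binomCoeff_succ {q : ℂ} (A : ℂ) {M : ℕ} (h : qPoch q q (M + 1) ≠ 0) :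
    binomCoeff q A (M + 1) = binomCoeff q (A * q) (M + 1) - A * binomCoeff q (A * q) M := by
  simp only [binomCoeff]
  rw [qPoch_succ' q A, qPoch_succ q (A * q)]
  rw [qPoch_succ] at h ⊢
  have h1 := left_ne_zero_of_mul h
  have h2 := right_ne_zero_of_mul h
  field_simp
  ring

/-- Coefficient form of $F_A(qu)=(1-u)F_{Aq}(u)$. -/
theorem pow_mul_binomCoeff_succ {q : ℂ} (A : ℂ) {M : ℕ} (h : qPoch q q (M + 1) ≠ 0) :
    q ^ (M + 1) * binomCoeff q A (M + 1) = binomCoeff q (A * q) (M + 1) - binomCoeff q (A * q) M := by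
  simp only [binomCoeff]
  rw [qPoch_succ' q A, qPoch_succ q (A * q)]
  rw [qPoch_succ] at h ⊢
  have h1 := left_ne_zero_of_mul h
  have h2 := right_ne_zero_of_mul h
  field_simp
  ring

/-- Replacing $b$ or $c$ by its $q$-multiple replaces $A$ by $Aq$, so the left side is the dual
contiguous relation weighted with the coefficients of $F_{Aq}$. On the right, $q^K$ splits over the
two indices, and the two functional equations of $F_A$ convert its coefficients to those of
$F_{Aq}$. Their lower-order parts produce exactly the degree-lowering term of the dual relation. -/
theorem eulerSum_contiguous {q t e f : ℂ} {K : ℕ} (h : A2Regular q t e f K) (b c d d' : ℂ) :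
    c * ((1 - b) * (1 - b / t)) * eulerSum q t e f (b * q) c d d' K -
      b * ((1 - c) * (1 - c / t)) * eulerSum q t e f b (c * q) d d' K =
    (c - b) * (1 - b * c * q ^ K / t) * eulerSum q t e f b c d d' K := by
  have ht := h.t_ne
  rcases K with _ | K
  · simp [eulerSum, binomCoeff_zero, dualSum_zero h]
    ring
  have hA1 : eulerArg q t e f (b * q) c d d' = eulerArg q t e f b c d d' * q := by
    unfold eulerArg; ring
  have hA2 : eulerArg q t e f b (c * q) d d' = eulerArg q t e f b c d d' * q := by
    unfold eulerArg; ring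
  simp only [eulerSum, hA1, hA2]
  set A := eulerArg q t e f b c d d' with hA
  set T := dualSum q t e f b c d d' with hT
  have hR : (1 - b * c * q ^ (K + 1) / t) * ∑ p ∈ antidiagonal (K + 1), binomCoeff q A p.1 * T p.2 =
      ∑ p ∈ antidiagonal (K + 1), binomCoeff q (A * q) p.1 * ((1 - b * c * q ^ p.2 / t) * T p.2) -
      ∑ p ∈ antidiagonal K, binomCoeff q (A * q) p.1 * ((A - b * c * q ^ p.2 / t) * T p.2) := by
    have : (1 - b * c * q ^ (K + 1) / t) * ∑ p ∈ antidiagonal (K + 1), binomCoeff q A p.1 * T p.2 =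
        ∑ p ∈ antidiagonal (K + 1), (binomCoeff q A p.1 -
          q ^ p.1 * binomCoeff q A p.1 * (b * c * q ^ p.2 / t)) * T p.2 := by
      rw [mul_sum]
      refine sum_congr rfl fun p hp => ?_
      rw [← mem_antidiagonal.1 hp]
      ring
    rw [this, Nat.sum_antidiagonal_succ, Nat.sum_antidiagonal_succ, add_sub_assoc,
      ← sum_sub_distrib]
    congr 1
    · simp only [binomCoeff_zero]
      ring
    · refine sum_congr rfl fun p hp => ?_
      have hp' := mem_antidiagonal.1 hp
      have hq := qPoch_ne_zero_mono h.qq (show p.1 + 1 ≤ K + 1 by omega)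
      rw [pow_mul_binomCoeff_succ A hq, binomCoeff_succ A hq]
      ring
  rw [mul_assoc (c - b), hR, mul_sum, mul_sum, ← sum_sub_distrib, mul_sub (c - b), mul_sum _ _ (c - b),
    mul_sum _ _ (c - b),
    Nat.sum_antidiagonal_succ', Nat.sum_antidiagonal_succ', add_sub_assoc, ← sum_sub_distrib]
  congr 1
  · simp only [dualSum_zero h, hT]
    ring
  · refine sum_congr rfl fun p hp => ?_
    have hp' := mem_antidiagonal.1 hp
    have := dualSum_contiguous (h.mono (show p.2 + 1 ≤ K + 1 by omega)) b c d d'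
    linear_combination binomCoeff q (A * q) p.1 * this

/-! ### Polynomials of bounded degree and the uniqueness theorem -/

/-- The function `g` is given by a polynomial of degree at most `K`. -/
def IsPolyOfDegreeLE (K : ℕ) (g : ℂ → ℂ) : Prop :=
  ∃ p : Polynomial ℂ, p.natDegree ≤ K ∧ ∀ x, g x = p.eval x

namespace IsPolyOfDegreeLE

variable {K L : ℕ} {g h : ℂ → ℂ}

theorem const (K : ℕ) (a : ℂ) : IsPolyOfDegreeLE K fun _ => a :=
  ⟨Polynomial.C a, by simp, by simp⟩

theorem linear (a b : ℂ) : IsPolyOfDegreeLE 1 fun x => a * x + b :=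
  ⟨Polynomial.C a * Polynomial.X + Polynomial.C b, Polynomial.natDegree_linear_le, by simp⟩

theorem mul (hg : IsPolyOfDegreeLE K g) (hh : IsPolyOfDegreeLE L h) :
    IsPolyOfDegreeLE (K + L) fun x => g x * h x := by
  obtain ⟨p, hp, hp'⟩ := hg
  obtain ⟨r, hr, hr'⟩ := hh
  exact ⟨p * r, Polynomial.natDegree_mul_le_of_le hp hr, fun x => by simp [hp', hr']⟩

theorem const_mul (a : ℂ) (hg : IsPolyOfDegreeLE K g) : IsPolyOfDegreeLE K fun x => a * g x := by
  simpa using (const 0 a).mul hg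

theorem mul_const (hg : IsPolyOfDegreeLE K g) (a : ℂ) : IsPolyOfDegreeLE K fun x => g x * a :=
  hg.mul (const 0 a)

theorem sub (hg : IsPolyOfDegreeLE K g) (hh : IsPolyOfDegreeLE K h) :
    IsPolyOfDegreeLE K fun x => g x - h x := by
  obtain ⟨p, hp, hp'⟩ := hg
  obtain ⟨r, hr, hr'⟩ := hh
  exact ⟨p - r, (Polynomial.natDegree_sub_le _ _).trans (max_le hp hr),
    fun x => by simp [hp', hr']⟩

theorem sum {ι : Type*} (s : Finset ι) {g : ι → ℂ → ℂ}
    (hg : ∀ i ∈ s, IsPolyOfDegreeLE K (g i)) : IsPolyOfDegreeLE K fun x => ∑ i ∈ s, g i x := by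
  choose! p hp hp' using hg
  refine ⟨∑ i ∈ s, p i, Polynomial.natDegree_sum_le_of_forall_le s p hp, fun x => ?_⟩
  rw [Polynomial.eval_finsetSum]
  exact sum_congr rfl fun i hi => hp' i hi x

theorem prod_range (n : ℕ) {a b : ℕ → ℂ} :
    IsPolyOfDegreeLE n fun x => ∏ j ∈ range n, (a j * x + b j) := by
  induction n with
  | zero => simpa using const 0 1
  | succ n ih =>
    simp only [prod_range_succ]
    exact ih.mul (linear _ _)

theorem qPoch_mul (q a : ℂ) (n : ℕ) : IsPolyOfDegreeLE n fun x => qPoch q (x * a) n := by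
  convert prod_range n (a := fun j => -(a * q ^ j)) (b := fun _ => 1) using 2 with x
  exact Finset.prod_congr rfl fun j _ => by ring

theorem eq_zero {ι : Type*} [Fintype ι] (hg : IsPolyOfDegreeLE K g) {z : ι → ℂ}
    (hz : Function.Injective z) (h0 : ∀ i, g (z i) = 0) (hcard : K < Fintype.card ι) (x : ℂ) :
    g x = 0 := by
  obtain ⟨p, hp, hp'⟩ := hg
  rw [hp', Polynomial.eq_zero_of_natDegree_lt_card_of_eval_eq_zero p hz
    (fun i => by rw [← hp', h0]) (hp.trans_lt hcard), Polynomial.eval_zero]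

end IsPolyOfDegreeLE

theorem pow_ne_pow_of_qPoch {q : ℂ} {K : ℕ} (hq : q ≠ 0) (hqq : qPoch q q K ≠ 0) {i j : ℕ} (hi : i ≤ K)
    (hj : j ≤ K) (hij : i ≠ j) : q ^ i ≠ q ^ j := by
  have main (i j : ℕ) (hij : i < j) (hj : j ≤ K) : q ^ i ≠ q ^ j := by
    obtain ⟨m, rfl⟩ := Nat.exists_eq_add_of_lt hij
    have := qPoch_ne_zero_iff.1 hqq m (by omega)
    intro h
    apply this
    have h2 : q ^ i * (1 - q * q ^ m) = 0 := by
      rw [pow_add, pow_add] at h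
      linear_combination h
    exact (mul_eq_zero.1 h2).resolve_left (pow_ne_zero _ hq)
  rcases lt_or_gt_of_ne hij with h | h
  · exact main i j h hj
  · exact (main j i h hi).symm

/-- The first condition excludes $t=q^m$ for $0\le m\le K$, the second $t=q^{-m}$ for $1\le m\le K$.
-/
theorem mul_pow_ne_pow {q t : ℂ} {K : ℕ} (hq : q ≠ 0) (ht : t ≠ 0)
    (hinv : qPoch q (1 / t) (K + 1) ≠ 0) (htq : qPoch q (t * q) K ≠ 0) {i j : ℕ} (hi : i ≤ K)
    (hj : j ≤ K) : t * q ^ i ≠ q ^ j := by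
  intro h
  rcases le_or_gt i j with hij | hij
  · obtain ⟨m, rfl⟩ := Nat.exists_eq_add_of_le hij
    refine qPoch_ne_zero_iff.1 hinv m (by omega) ?_
    rw [pow_add, mul_comm, mul_right_inj' (pow_ne_zero _ hq)] at h
    rw [← h]
    field_simp
    ring
  · obtain ⟨m, rfl⟩ := Nat.exists_eq_add_of_lt hij
    refine qPoch_ne_zero_iff.1 htq m (by omega) ?_
    have h2 : q ^ j * (1 - t * q * q ^ m) = 0 := by
      rw [pow_add, pow_add] at h
      linear_combination -h
    exact (mul_eq_zero.1 h2).resolve_left (pow_ne_zero _ hq)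

/-- Induction on $n$ at $b=q^{-n}$. The term with $D(bq,c)$ drops out, by induction or because
$1-b=0$, leaving a homogeneous first-order recurrence in $c$. Its coefficient $(1-c)(1-c/t)$ starts
chains of zeros at $c=1$ and $c=t$, of lengths $n$ and $K-n$. With the prescribed zero these are
$K+1$ zeros in $c$; the $K+1$ values of $b$ then finish the proof. -/
theorem eq_zero_of_contiguous {q t : ℂ} {K : ℕ} (hq : q ≠ 0) (ht : t ≠ 0)
    (hqq : qPoch q q K ≠ 0) (hinv : qPoch q (1 / t) (K + 1) ≠ 0) (htq : qPoch q (t * q) K ≠ 0)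
    {D : ℂ → ℂ → ℂ} (hD : ∀ b, IsPolyOfDegreeLE K (D b))
    (hD' : ∀ c, IsPolyOfDegreeLE K fun b => D b c)
    (hrel : ∀ b c, c * ((1 - b) * (1 - b / t)) * D (b * q) c -
      b * ((1 - c) * (1 - c / t)) * D b (c * q) = (c - b) * (1 - b * c * q ^ K / t) * D b c)
    (hnorm : ∀ n ≤ K, ∃ c, D (q ^ n)⁻¹ c = 0 ∧ (∀ j < n, (q ^ j)⁻¹ ≠ c) ∧
      ∀ i < K - n, t * (q ^ i)⁻¹ ≠ c) (b c : ℂ) : D b c = 0 := by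
  have hpow (i : ℕ) : q ^ i ≠ 0 := pow_ne_zero i hq
  have step : ∀ n ≤ K, (∀ c, (1 - (q ^ n)⁻¹) * D ((q ^ n)⁻¹ * q) c = 0) →
      ∀ c, D (q ^ n)⁻¹ c = 0 := by
    intro n hn h0
    have hom (c : ℂ) : (q ^ n)⁻¹ * ((1 - c) * (1 - c / t)) * D (q ^ n)⁻¹ (c * q) =
        ((q ^ n)⁻¹ - c) * (1 - (q ^ n)⁻¹ * c * q ^ K / t) * D (q ^ n)⁻¹ c := by
      linear_combination -hrel (q ^ n)⁻¹ c + c * (1 - (q ^ n)⁻¹ / t) * h0 c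
    have shift (j : ℕ) : (q ^ (j + 1))⁻¹ * q = (q ^ j)⁻¹ := by
      rw [pow_succ, mul_inv, mul_assoc, inv_mul_cancel₀ hq, mul_one]
    -- This chain stops at $j=n$, where the factor $b-c$ vanishes.
    have zero1 : ∀ j < n, D (q ^ n)⁻¹ (q ^ j)⁻¹ = 0 := by
      have next (j : ℕ) (hj : j < n) (h : (1 - (q ^ j)⁻¹) * D (q ^ n)⁻¹ ((q ^ j)⁻¹ * q) = 0) :
          D (q ^ n)⁻¹ (q ^ j)⁻¹ = 0 := by
        have h1 : (q ^ n)⁻¹ - (q ^ j)⁻¹ ≠ 0 := fun h =>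
          pow_ne_pow_of_qPoch hq hqq hn (by omega) (by omega) (inv_injective (sub_eq_zero.1 h))
        have h2 : 1 - (q ^ n)⁻¹ * (q ^ j)⁻¹ * q ^ K / t ≠ 0 := by
          intro h
          have e1 := hpow j
          have e2 := hpow n
          rw [show q ^ K = q ^ (K - n) * q ^ n by rw [← pow_add]; congr 1; omega] at h
          field_simp at h
          exact mul_pow_ne_pow hq ht hinv htq (i := j) (j := K - n) (by omega) (by omega)
            (by linear_combination h)
        have h3 := hom (q ^ j)⁻¹
        rw [show (q ^ n)⁻¹ * ((1 - (q ^ j)⁻¹) * (1 - (q ^ j)⁻¹ / t)) *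
          D (q ^ n)⁻¹ ((q ^ j)⁻¹ * q) = 0 by
            linear_combination (q ^ n)⁻¹ * (1 - (q ^ j)⁻¹ / t) * h] at h3
        exact (mul_eq_zero.1 h3.symm).resolve_left (mul_ne_zero h1 h2)
      intro j
      induction j with
      | zero => exact fun hj => next 0 hj (by simp)
      | succ j ih => exact fun hj => next (j + 1) hj (by rw [shift, ih (by omega), mul_zero])
    -- This chain stops at $i=K-n$, where $1-bcq^K/t$ vanishes.
    have zero2 : ∀ i < K - n, D (q ^ n)⁻¹ (t * (q ^ i)⁻¹) = 0 := by
      have next (i : ℕ) (hi : i < K - n)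
          (h : (1 - (q ^ i)⁻¹) * D (q ^ n)⁻¹ (t * (q ^ i)⁻¹ * q) = 0) :
          D (q ^ n)⁻¹ (t * (q ^ i)⁻¹) = 0 := by
        have e1 := hpow i
        have e2 := hpow n
        have h1 : (q ^ n)⁻¹ - t * (q ^ i)⁻¹ ≠ 0 := by
          intro h
          field_simp at h
          exact mul_pow_ne_pow hq ht hinv htq (i := n) (j := i) (by omega) (by omega)
            (by linear_combination -h)
        have h2 : 1 - (q ^ n)⁻¹ * (t * (q ^ i)⁻¹) * q ^ K / t ≠ 0 := by
          intro h
          rw [show q ^ K = q ^ (K - n) * q ^ n by rw [← pow_add]; congr 1; omega] at h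
          field_simp at h
          exact pow_ne_pow_of_qPoch hq hqq (i := i) (j := K - n) (by omega) (by omega) (by omega)
            (by linear_combination h)
        have h3 := hom (t * (q ^ i)⁻¹)
        rw [show (q ^ n)⁻¹ * ((1 - t * (q ^ i)⁻¹) * (1 - t * (q ^ i)⁻¹ / t)) *
          D (q ^ n)⁻¹ (t * (q ^ i)⁻¹ * q) = 0 by
            rw [mul_div_cancel_left₀ _ ht]
            linear_combination (q ^ n)⁻¹ * (1 - t * (q ^ i)⁻¹) * h] at h3
        exact (mul_eq_zero.1 h3.symm).resolve_left (mul_ne_zero h1 h2)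
      intro i
      induction i with
      | zero => exact fun hi => next 0 hi (by simp)
      | succ i ih =>
        exact fun hi => next (i + 1) hi (by rw [mul_assoc, shift, ih (by omega), mul_zero])
    obtain ⟨c0, hc0, hc1, hc2⟩ := hnorm n hn
    intro c
    refine (hD _).eq_zero (z := Sum.elim (fun j : Fin n => (q ^ (j : ℕ))⁻¹)
      (Sum.elim (fun i : Fin (K - n) => t * (q ^ (i : ℕ))⁻¹) fun _ : Unit => c0)) ?_ ?_ ?_ c
    · refine Function.Injective.sumElim ?_ (Function.Injective.sumElim ?_
        (Function.injective_of_subsingleton _) fun i _ => hc2 i i.2) ?_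
      · intro i j hij
        by_contra hne
        exact pow_ne_pow_of_qPoch hq hqq (i := i) (j := j) (by omega) (by omega)
          (fun h => hne (Fin.ext h)) (inv_injective hij)
      · intro i j hij
        by_contra hne
        exact pow_ne_pow_of_qPoch hq hqq (i := i) (j := j) (by omega) (by omega)
          (fun h => hne (Fin.ext h)) (inv_injective (mul_left_cancel₀ ht hij))
      · rintro j (i | _)
        · intro h
          simp only [Sum.elim_inl] at h
          refine mul_pow_ne_pow hq ht hinv htq (i := j) (j := i) (by omega) (by omega) ?_
          have := hpow i
          have := hpow j
          field_simp at h
          linear_combination -h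
        · exact hc1 j j.2
    · rintro (j | i | _)
      · exact zero1 j j.2
      · exact zero2 i i.2
      · exact hc0
    · simp only [Fintype.card_sum, Fintype.card_fin, Fintype.card_unit]
      omega
  have main : ∀ n ≤ K, ∀ c, D (q ^ n)⁻¹ c = 0 := by
    intro n
    induction n with
    | zero => exact fun hn => step 0 hn fun c => by simp
    | succ n ih =>
      refine fun hn => step (n + 1) hn fun c => ?_
      rw [show (q ^ (n + 1))⁻¹ * q = (q ^ n)⁻¹ by
        rw [pow_succ, mul_inv, mul_assoc, inv_mul_cancel₀ hq, mul_one], ih (by omega), mul_zero]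
  refine (hD' c).eq_zero (z := fun n : Fin (K + 1) => (q ^ (n : ℕ))⁻¹) ?_
    (fun n => main n (by omega) c) (by simp) b
  intro i j hij
  by_contra hne
  exact pow_ne_pow_of_qPoch hq hqq (i := i) (j := j) (by omega) (by omega)
    (fun h => hne (Fin.ext h)) (inv_injective hij)

/-! ### The Euler transformation -/

theorem isPoly_a2Num (q t : ℂ) (i k : ℕ) : IsPolyOfDegreeLE (i + k) fun x => a2Num q t x i k := by
  have := (IsPolyOfDegreeLE.qPoch_mul q t⁻¹ i).mul (IsPolyOfDegreeLE.qPoch_mul q 1 k)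
  simpa [a2Num, div_eq_mul_inv] using this

theorem isPoly_a2Sum (q t e f c d d' : ℂ) (K : ℕ) :
    IsPolyOfDegreeLE K fun b => a2Sum q t e f b c d d' K := by
  refine IsPolyOfDegreeLE.sum _ fun p hp => IsPolyOfDegreeLE.const_mul _ ?_
  rw [← mem_antidiagonal.1 hp]
  exact (((isPoly_a2Num q t _ _).mul_const _).mul_const _).mul_const _

theorem isPoly_dualNum (q t e f : ℂ) (i k : ℕ) :
    IsPolyOfDegreeLE (i + k) fun x => dualNum q t e f x i k := by
  have := (IsPolyOfDegreeLE.prod_range i (a := fun _ => 1)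
    (b := fun j => -(t * q ^ (j + 1) / f))).mul (IsPolyOfDegreeLE.prod_range k (a := fun _ => 1)
    (b := fun j => -(t * q ^ (j + 1) / e)))
  simpa [dualNum, sub_eq_add_neg] using this

theorem isPoly_dualSum (q t e f c d d' : ℂ) (L : ℕ) :
    IsPolyOfDegreeLE L fun b => dualSum q t e f b c d d' L := by
  refine IsPolyOfDegreeLE.const_mul _ (IsPolyOfDegreeLE.sum _ fun p hp =>
    IsPolyOfDegreeLE.const_mul _ ?_)
  rw [← mem_antidiagonal.1 hp]
  exact (((isPoly_dualNum q t e f _ _).mul_const _).mul_const _).mul_const _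

theorem isPoly_eulerSum (q t e f c d d' : ℂ) (K : ℕ) :
    IsPolyOfDegreeLE K fun b => eulerSum q t e f b c d d' K := by
  refine IsPolyOfDegreeLE.sum _ fun p hp => ?_
  rw [← mem_antidiagonal.1 hp]
  refine IsPolyOfDegreeLE.mul ?_ (isPoly_dualSum q t e f c d d' _)
  have := (IsPolyOfDegreeLE.qPoch_mul q (c * d * d' * (e * f / (t ^ 3 * q ^ 2))) p.1).mul_const
    (qPoch q q p.1)⁻¹
  simpa only [binomCoeff, eulerArg, mul_assoc, div_eq_mul_inv] using this

/-- The defect of the Euler transformation in degree `K`. -/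
noncomputable def eulerDefect (q t e f : ℂ) (K : ℕ) (b c d d' : ℂ) : ℂ :=
  a2Sum q t e f b c d d' K - eulerSum q t e f b c d d' K

theorem eulerDefect_swap (q t e f : ℂ) (K : ℕ) (b c d d' : ℂ) :
    eulerDefect q t e f K b c d d' = eulerDefect q t e f K c b d d' := by
  simp only [eulerDefect, a2Sum, eulerSum, eulerArg, dualSum, mul_comm c b,
    mul_comm (a2Num q t c _ _) (a2Num q t b _ _), mul_comm (dualNum q t e f c _ _)]

theorem eulerDefect_swap' (q t e f : ℂ) (K : ℕ) (b c d d' : ℂ) :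
    eulerDefect q t e f K b c d d' = eulerDefect q t e f K b d c d' := by
  simp only [eulerDefect, a2Sum, eulerSum, eulerArg, dualSum, mul_right_comm _ d c,
    mul_right_comm _ (a2Num q t d _ _) (a2Num q t c _ _),
    mul_right_comm _ (dualNum q t e f d _ _) (dualNum q t e f c _ _)]

theorem eulerDefect_swap'' (q t e f : ℂ) (K : ℕ) (b c d d' : ℂ) :
    eulerDefect q t e f K b c d d' = eulerDefect q t e f K b c d' d := by
  simp only [eulerDefect, a2Sum, eulerSum, eulerArg, dualSum, mul_right_comm _ d' d,
    mul_right_comm _ (a2Num q t d' _ _) (a2Num q t d _ _),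
    mul_right_comm _ (dualNum q t e f d' _ _) (dualNum q t e f d _ _)]

theorem eulerDefect_eq_zero_of_norm {q t e f : ℂ} {K : ℕ} (h : A2Regular q t e f K) (d d' : ℂ)
    (hnorm : ∀ n ≤ K, ∃ c, eulerDefect q t e f K (q ^ n)⁻¹ c d d' = 0 ∧
      (∀ j < n, (q ^ j)⁻¹ ≠ c) ∧ ∀ i < K - n, t * (q ^ i)⁻¹ ≠ c) (b c : ℂ) :
    eulerDefect q t e f K b c d d' = 0 := by
  have hp (c : ℂ) : IsPolyOfDegreeLE K fun b => eulerDefect q t e f K b c d d' :=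
    (isPoly_a2Sum q t e f c d d' K).sub (isPoly_eulerSum q t e f c d d' K)
  refine eq_zero_of_contiguous (D := fun b c => eulerDefect q t e f K b c d d') h.q_ne h.t_ne h.qq
    h.inv_t h.tq (fun b => ?_) hp (fun b c => ?_) hnorm b c
  · simp only [eulerDefect_swap q t e f K b]
    exact hp b
  · have h1 := a2Sum_contiguous q t e f b c d d' K
    have h2 := eulerSum_contiguous h b c d d'
    simp only [eulerDefect]
    linear_combination h1 - h2

/-- The value $c=tq/e'$ avoids both chains of automatic zeros precisely because of the two
nonvanishing conditions. It is used with $e'=e$ and $e'=f$. -/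
theorem eulerDefect_norm {q t e f : ℂ} {K : ℕ} (h : A2Regular q t e f K) {e' : ℂ}
    (hte : qPoch q (t * q / e') K ≠ 0) (hqe : qPoch q (q / e') K ≠ 0) (d d' : ℂ)
    (h0 : ∀ b, eulerDefect q t e f K b (t * q / e') d d' = 0) (b c : ℂ) :
    eulerDefect q t e f K b c d d' = 0 := by
  refine eulerDefect_eq_zero_of_norm h d d' (fun n hn => ⟨t * q / e', h0 _, fun j hj hc => ?_,
    fun i hi hc => ?_⟩) b c
  · refine qPoch_ne_zero_iff.1 hte j (by omega) ?_
    rw [← hc, inv_mul_cancel₀ (pow_ne_zero _ h.q_ne), sub_self]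
  · refine qPoch_ne_zero_iff.1 hqe i (by omega) ?_
    rw [mul_div_assoc, mul_right_inj' h.t_ne] at hc
    rw [← hc, inv_mul_cancel₀ (pow_ne_zero _ h.q_ne), sub_self]

theorem qPoch_inv_pow_eq_zero {q : ℂ} (hq : q ≠ 0) {n k : ℕ} (h : n < k) :
    qPoch q (q ^ n)⁻¹ k = 0 := by
  rw [qPoch, Finset.prod_eq_zero (mem_range.2 h)]
  rw [inv_mul_cancel₀ (pow_ne_zero _ hq), sub_self]

/-- Since $(q^{-n})_n=(-1)^nq^{-n(n+1)/2}(q)_n$, the power $q^{nm}$ is the cross term of the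
quadratic exponents. -/
theorem qPoch_inv_pow_mul {q : ℂ} (hq : q ≠ 0) (n m : ℕ) :
    qPoch q (q ^ n)⁻¹ n * qPoch q (q ^ m)⁻¹ m * qPoch q q (m + n) =
      q ^ (n * m) * qPoch q (q ^ (m + n))⁻¹ (m + n) * qPoch q q n * qPoch q q m := by
  have shift (j : ℕ) : (q ^ (j + 1))⁻¹ * q = (q ^ j)⁻¹ := by
    rw [pow_succ, mul_inv, mul_assoc, inv_mul_cancel₀ hq, mul_one]
  induction m with
  | zero => simp [qPoch_zero]
  | succ m ih =>
    rw [show m + 1 + n = m + n + 1 by ring, qPoch_succ' q (q ^ (m + 1))⁻¹,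
      qPoch_succ' q (q ^ (m + n + 1))⁻¹, qPoch_succ q q, shift, shift, qPoch_succ q q]
    have h1 : 1 - (q ^ (m + 1))⁻¹ = -(q ^ (m + 1))⁻¹ * (1 - q * q ^ m) := by
      field_simp
      ring
    have h2 : q ^ (n * (m + 1)) * (1 - (q ^ (m + n + 1))⁻¹) =
        q ^ (n * m) * -(q ^ (m + 1))⁻¹ * (1 - q * q ^ (m + n)) := by
      field_simp
      ring
    rw [h1]
    linear_combination (-(q ^ (m + 1))⁻¹ * (1 - q * q ^ m) * (1 - q * q ^ (m + n))) * ih -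
      qPoch q (q ^ (m + n))⁻¹ (m + n) * qPoch q q n * qPoch q q m * (1 - q * q ^ m) * h2

theorem qPoch_inv_pow_div_mul {q t : ℂ} (hq : q ≠ 0) (ht : t ≠ 0) (m n : ℕ) :
    qPoch q ((q ^ n)⁻¹ / t) m * qPoch q (t * (q ^ m)⁻¹) n * (q ^ m - t * q ^ n) * q ^ (n * m) =
      (1 - t) * qPoch q (q / t) m * qPoch q (t * q) n := by
  induction n with
  | zero =>
    have := (qPoch_succ' q (1 / t) m).symm.trans (qPoch_succ q (1 / t) m)
    rw [show 1 / t * q = q / t by ring] at this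
    simp only [pow_zero, inv_one, qPoch_zero, zero_mul, mul_one]
    field_simp at this
    linear_combination this
  | succ n ih =>
    have h1 := (qPoch_succ' q ((q ^ (n + 1))⁻¹ / t) m).symm.trans (qPoch_succ q _ m)
    rw [show (q ^ (n + 1))⁻¹ / t * q = (q ^ n)⁻¹ / t by field_simp; ring] at h1
    rw [qPoch_succ, qPoch_succ]
    have h2 : 1 - (q ^ (n + 1))⁻¹ / t * q ^ m = (t * q ^ (n + 1) - q ^ m) / (t * q ^ (n + 1)) := by
      field_simp
    have h3 : 1 - (q ^ (n + 1))⁻¹ / t = -(1 - t * q * q ^ n) / (t * q ^ (n + 1)) := by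
      field_simp
      ring
    have h4 : 1 - t * (q ^ m)⁻¹ * q ^ n = (q ^ m - t * q ^ n) / q ^ m := by
      field_simp
    generalize qPoch q ((q ^ n)⁻¹ / t) m = X at *
    generalize qPoch q ((q ^ (n + 1))⁻¹ / t) m = Y at *
    have h5 : (1 - t * q * q ^ n) * X =
        Y * (q ^ m - t * q ^ (n + 1)) := by
      rw [h2, h3] at h1
      field_simp at h1
      linear_combination -h1
    have h6 : (q ^ m - t * q ^ n) / q ^ m * q ^ m = q ^ m - t * q ^ n :=
      div_mul_cancel₀ _ (pow_ne_zero _ hq)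
    rw [h4, show (n + 1) * m = n * m + m by ring, pow_add]
    linear_combination (1 - t * q * q ^ n) * ih -
      qPoch q (t * (q ^ m)⁻¹) n * (q ^ m - t * q ^ n) * q ^ (n * m) * h5 +
      Y * qPoch q (t * (q ^ m)⁻¹) n * (q ^ m - t * q ^ (n + 1)) *
        q ^ (n * m) * h6

/-- The parameter $tq/e$ kills all terms with $k\ge1$, and $tq/f$ those with $i\ge1$. -/
theorem dualSum_degenerate {q t e f : ℂ} (b c : ℂ) (L : ℕ) :
    dualSum q t e f b c (t * q / e) (t * q / f) (L + 1) = 0 := by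
  rw [dualSum, sum_eq_zero, mul_zero]
  rintro ⟨i, k⟩ hp
  have hp' := mem_antidiagonal.1 hp
  simp only at hp' ⊢
  rcases i with _ | i
  · obtain ⟨k, rfl⟩ : ∃ l, k = l + 1 := ⟨L, by omega⟩
    have : dualNum q t e f (t * q / e) 0 (k + 1) = 0 := by simp [dualNum, prod_range_succ']
    rw [this]
    ring
  · have : dualNum q t e f (t * q / f) (i + 1) k = 0 := by simp [dualNum, prod_range_succ']
    rw [this]
    ring

/-- The parameter $q^{-n}$ kills $k>n$ and $tq^{-m}$ kills $i>m$, so only $(m,n)$ survives when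
$i+k=m+n$. The other two parameters cancel the denominators containing $e$ and $f$. -/
theorem a2Sum_degenerate {q t e f : ℂ} {m n : ℕ} (h : A2Regular q t e f (m + n)) :
    a2Sum q t e f (q ^ n)⁻¹ (t * (q ^ m)⁻¹) (t * q / e) (t * q / f) (m + n) =
      qPoch q (q ^ (m + n))⁻¹ (m + n) / qPoch q q (m + n) := by
  have hq := h.q_ne
  have ht := h.t_ne
  rw [a2Sum, sum_eq_single (m, n)]
  · have h1 := qPoch_inv_pow_mul hq n m
    have h2 := qPoch_inv_pow_div_mul hq ht m n
    have hm := h.mono (show m ≤ m + n by omega)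
    have hn := h.mono (show n ≤ m + n by omega)
    have c1 := hm.qq
    have c2 := hn.qq
    have c3 := h.qq
    have c4 := hm.qe
    have c5 := hm.qf
    have c6 := hn.te
    have c7 := hn.tf
    have c8 := hn.tq
    have c9 := h.one_sub_t_ne
    have c10 : qPoch q (q / t) m ≠ 0 := by
      have := hm.inv_t
      rw [qPoch_succ'] at this
      have := right_ne_zero_of_mul this
      rwa [show 1 / t * q = q / t by ring] at this
    have c11 : q ^ (n * m) ≠ 0 := pow_ne_zero _ hq
    simp only [a2Weight, a2Num]
    rw [show t * q / e / t = q / e by field_simp, show t * q / f / t = q / f by field_simp,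
      show t * (q ^ m)⁻¹ / t = (q ^ m)⁻¹ by field_simp]
    generalize qPoch q (q / e) m = x1 at *
    generalize qPoch q (q / f) m = x2 at *
    generalize qPoch q (q / t) m = x3 at *
    generalize qPoch q (t * q / e) n = x4 at *
    generalize qPoch q (t * q / f) n = x5 at *
    generalize qPoch q (t * q) n = x6 at *
    generalize qPoch q (q ^ n)⁻¹ n = x7 at *
    generalize qPoch q (q ^ m)⁻¹ m = x8 at *
    generalize qPoch q (q ^ (m + n))⁻¹ (m + n) = x9 at *
    generalize qPoch q q (m + n) = x10 at *
    generalize qPoch q q m = x11 at *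
    generalize qPoch q q n = x12 at *
    generalize qPoch q ((q ^ n)⁻¹ / t) m = x13 at *
    generalize qPoch q (t * (q ^ m)⁻¹) n = x14 at *
    generalize q ^ m - t * q ^ n = x15 at *
    generalize q ^ (n * m) = x16 at *
    generalize 1 - t = x17 at *
    field_simp
    refine mul_right_cancel₀ c11 ?_
    linear_combination x7 * x8 * x10 * h2 + x17 * x3 * x6 * h1
  · rintro ⟨i, k⟩ hp hne
    have hp' := mem_antidiagonal.1 hp
    simp only at hp' ⊢
    rcases lt_trichotomy i m with hi | rfl | hi
    · have : a2Num q t (q ^ n)⁻¹ i k = 0 := by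
        rw [a2Num, qPoch_inv_pow_eq_zero hq (show n < k by omega), mul_zero]
      rw [this]
      ring
    · obtain rfl : k = n := by omega
      exact absurd rfl hne
    · have : a2Num q t (t * (q ^ m)⁻¹) i k = 0 := by
        rw [a2Num, mul_div_cancel_left₀ _ ht, qPoch_inv_pow_eq_zero hq hi, zero_mul]
      rw [this]
      ring
  · simp

theorem euler_transformation {q t e f : ℂ} {K : ℕ} (h : A2Regular q t e f K) (b c d d' : ℂ) :
    a2Sum q t e f b c d d' K = eulerSum q t e f b c d d' K := by
  have base (b c : ℂ) : eulerDefect q t e f K b c (t * q / e) (t * q / f) = 0 := by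
    -- The point $c=tq^{-(K-n)}$ is the first one beyond the second chain of zeros. There
    -- $A=q^{-K}$, and the single surviving terms agree.
    refine eulerDefect_eq_zero_of_norm h _ _ (fun n hn => ⟨t * (q ^ (K - n))⁻¹, ?_,
      fun j hj hc => ?_, fun i hi hc => ?_⟩) b c
    · obtain ⟨m, rfl⟩ : ∃ m, K = m + n := ⟨K - n, by omega⟩
      have hq := h.q_ne
      have ht := h.t_ne
      have he := h.e_ne
      have hf := h.f_ne
      have hA : eulerArg q t e f (q ^ n)⁻¹ (t * (q ^ m)⁻¹) (t * q / e) (t * q / f) =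
          (q ^ (m + n))⁻¹ := by
        rw [eulerArg]
        field_simp
        ring
      rw [Nat.add_sub_cancel, eulerDefect, a2Sum_degenerate h, eulerSum, hA, sub_eq_zero,
        sum_eq_single (m + n, 0), dualSum_zero h, mul_one, binomCoeff]
      · rintro ⟨i, k⟩ hp hne
        rcases k with _ | k
        · have := mem_antidiagonal.1 hp
          exact absurd (by simpa using this) hne
        · rw [dualSum_degenerate, mul_zero]
      · simp
    · have := pow_ne_zero j h.q_ne
      have := pow_ne_zero (K - n) h.q_ne
      field_simp at hc
      exact mul_pow_ne_pow h.q_ne h.t_ne h.inv_t h.tq (i := j) (j := K - n) (by omega) (by omega)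
        (by linear_combination -hc)
    · exact pow_ne_pow_of_qPoch h.q_ne h.qq (i := i) (j := K - n) (by omega) (by omega) (by omega)
        (inv_injective (mul_left_cancel₀ h.t_ne hc))
  -- By symmetry a known vanishing at $d=tq/e$ serves as the normalisation in $c$, which frees $d$;
  -- `h2` frees $d'$ in the same way.
  have h1 (b c d : ℂ) : eulerDefect q t e f K b c d (t * q / f) = 0 :=
    eulerDefect_norm h h.te h.qe _ _
      (fun b => by rw [eulerDefect_swap']; exact base _ _) b c
  have h2 : eulerDefect q t e f K b c d d' = 0 :=
    eulerDefect_norm h h.tf h.qf _ _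
      (fun b => by rw [eulerDefect_swap', eulerDefect_swap'']; exact h1 _ _ _) b c
  exact sub_eq_zero.1 h2

/-! ### Very-well-poised series as double sums -/

/-- The factor `(-1)^k q^{-(m + (m+1) + ⋯ + (m+k-1))}` produced by reversing a shifted factorial. -/
noncomputable def revFactor (q : ℂ) (k m : ℕ) : ℂ := ∏ i ∈ range k, (-(q ^ (m + i))⁻¹)

theorem revFactor_ne_zero {q : ℂ} (hq : q ≠ 0) (k m : ℕ) : revFactor q k m ≠ 0 := by
  simp [revFactor, Finset.prod_ne_zero_iff, hq]

theorem qPoch_reverse {q y : ℂ} (hq : q ≠ 0) (hy : y ≠ 0) (k m : ℕ) :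
    qPoch q (q / (y * q ^ (m + k))) k * qPoch q y m =
      revFactor q k m * (1 / y) ^ k * qPoch q y (m + k) := by
  induction k with
  | zero => simp [revFactor, qPoch_zero]
  | succ k ih =>
    rw [qPoch_succ', show q / (y * q ^ (m + (k + 1))) * q = q / (y * q ^ (m + k)) by
      field_simp; ring, show m + (k + 1) = m + k + 1 by ring, qPoch_succ q y, revFactor,
      prod_range_succ, ← revFactor, pow_succ (1 / y)]
    have h1 : 1 - q / (y * q ^ (m + k + 1)) = -(q ^ (m + k))⁻¹ * (1 / y) * (1 - y * q ^ (m + k)) := by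
      field_simp
      ring
    rw [h1]
    linear_combination (-(q ^ (m + k))⁻¹ * (1 / y) * (1 - y * q ^ (m + k))) * ih

theorem qPoch_reverse_of_eq {q x y : ℂ} (hq : q ≠ 0) (hy : y ≠ 0) (k m : ℕ)
    (hx : x * (y * q ^ (m + k)) = q) :
    qPoch q x k * qPoch q y m = revFactor q k m * (1 / y) ^ k * qPoch q y (m + k) := by
  rw [← qPoch_reverse hq hy, eq_div_of_mul_eq (mul_ne_zero hy (pow_ne_zero _ hq)) hx]

/-- With $K=m+k$, every factorial whose argument contains $q^{-K}$, apart from those where it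
cancels, is reversed. The reversal factors cancel, four against four, and the argument of the ₁₀W₉
is what makes the remaining $k$-th powers cancel (`hp`). -/
theorem vwp_term_eq {q t e f b c d d' : ℂ} {m k : ℕ} (h : A2Regular q t e f (m + k))
    (hb : b ≠ 0) (hc : c ≠ 0) (hd : d ≠ 0) (hd' : d' ≠ 0)
    (hb1 : qPoch q (b / t) (m + k) ≠ 0) (hc1 : qPoch q (c / t) (m + k) ≠ 0)
    (hd1 : qPoch q (d / t) (m + k) ≠ 0) (hd1' : qPoch q (d' / t) (m + k) ≠ 0) :
    qPochs q [b / t, c / t, d / t, d' / t] (m + k) / qPochs q [q, 1 / t, q / e, q / f] (m + k) *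
      ((1 - t * (q ^ (m + k))⁻¹ * q ^ (2 * k)) / (1 - t * (q ^ (m + k))⁻¹) *
      (qPochs q (t * (q ^ (m + k))⁻¹ :: [b, c, d, d', e * (q ^ (m + k))⁻¹, f * (q ^ (m + k))⁻¹,
        (q ^ (m + k))⁻¹]) k / qPochs q (q :: [b, c, d, d', e * (q ^ (m + k))⁻¹,
        f * (q ^ (m + k))⁻¹, (q ^ (m + k))⁻¹].map fun a => t * (q ^ (m + k))⁻¹ * q / a) k) *
        (t ^ 3 * q ^ 3 / (b * c * d * d' * e * f)) ^ k) =
    a2Weight q t e f m k * (a2Num q t b m k * a2Num q t c m k * a2Num q t d m k *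
      a2Num q t d' m k) := by
  have hq := h.q_ne
  have ht := h.t_ne
  have he := h.e_ne
  have hf := h.f_ne
  have hQ : q ^ (m + k) ≠ 0 := pow_ne_zero _ hq
  have h1t := h.one_sub_t_ne
  have hm := h.mono (Nat.le_add_right m k)
  have hk := h.mono (Nat.le_add_left k m)
  have rb := qPoch_reverse_of_eq (x := t * (q ^ (m + k))⁻¹ * q / b) (y := b / t) hq
    (div_ne_zero hb ht) k m (by field_simp)
  have rc := qPoch_reverse_of_eq (x := t * (q ^ (m + k))⁻¹ * q / c) (y := c / t) hq
    (div_ne_zero hc ht) k m (by field_simp)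
  have rd := qPoch_reverse_of_eq (x := t * (q ^ (m + k))⁻¹ * q / d) (y := d / t) hq
    (div_ne_zero hd ht) k m (by field_simp)
  have rd' := qPoch_reverse_of_eq (x := t * (q ^ (m + k))⁻¹ * q / d') (y := d' / t) hq
    (div_ne_zero hd' ht) k m (by field_simp)
  have re := qPoch_reverse_of_eq (x := e * (q ^ (m + k))⁻¹) (y := q / e) hq
    (div_ne_zero hq he) k m (by field_simp)
  have rf := qPoch_reverse_of_eq (x := f * (q ^ (m + k))⁻¹) (y := q / f) hq
    (div_ne_zero hq hf) k m (by field_simp)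
  have rq := qPoch_reverse_of_eq (x := (q ^ (m + k))⁻¹) (y := q) hq hq k m (by field_simp)
  have rt := qPoch_reverse_of_eq (x := t * (q ^ (m + k))⁻¹) (y := q / t) hq
    (div_ne_zero hq ht) k m (by field_simp)
  have hs := (qPoch_succ' q (1 / t) (m + k)).symm.trans (qPoch_succ q (1 / t) (m + k))
  have hi := h.inv_t
  rw [qPoch_succ] at hi
  have i1 := left_ne_zero_of_mul hi
  have i2 := right_ne_zero_of_mul hi
  rw [← qPoch_succ, qPoch_succ', show 1 / t * q = q / t by ring] at hi
  rw [show 1 / t * q = q / t by ring] at hs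
  have i3 := right_ne_zero_of_mul hi
  have hω := revFactor_ne_zero hq k m
  have j1 : q ^ (m + k) - t ≠ 0 := by
    intro h
    apply i2
    rw [show q ^ (m + k) = t by linear_combination h]
    field_simp
    ring
  have w1 : (1 - t * (q ^ (m + k))⁻¹ * q ^ (2 * k)) / (1 - t * (q ^ (m + k))⁻¹) =
      q ^ k * (q ^ m - t * q ^ k) / (q ^ (m + k) - t) := by
    have : 1 - t * (q ^ (m + k))⁻¹ ≠ 0 := by
      rw [show 1 - t * (q ^ (m + k))⁻¹ = (q ^ (m + k) - t) / q ^ (m + k) by field_simp]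
      exact div_ne_zero j1 hQ
    rw [div_eq_div_iff this j1]
    field_simp
    ring
  -- The very-well-poised denominator $1-tq^{-K}$ merges with $(1/t)_K$.
  have w2 : qPoch q (1 / t) (m + k) * (q ^ (m + k) - t) = (1 - t) * qPoch q (q / t) (m + k) := by
    field_simp at hs
    linear_combination hs
  have k1 : qPoch q (q / t) m ≠ 0 := qPoch_ne_zero_mono i3 (by omega)
  have k2 := hm.qq
  have k3 := hm.qe
  have k4 := hm.qf
  have k5 := hk.qq
  have k6 := hk.tq
  have k7 := hk.te
  have k8 := hk.tf
  have l1 := h.qq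
  have l2 := h.qe
  have l3 := h.qf
  have m1 := qPoch_ne_zero_mono hb1 (Nat.le_add_right m k)
  have m2 := qPoch_ne_zero_mono hc1 (Nat.le_add_right m k)
  have m3 := qPoch_ne_zero_mono hd1 (Nat.le_add_right m k)
  have m4 := qPoch_ne_zero_mono hd1' (Nat.le_add_right m k)
  simp only [qPochs, List.map_cons, List.map_nil, List.prod_cons, List.prod_nil, mul_one, w1,
    a2Weight, a2Num]
  rw [show t * (q ^ (m + k))⁻¹ * q / (e * (q ^ (m + k))⁻¹) = t * q / e by field_simp,
    show t * (q ^ (m + k))⁻¹ * q / (f * (q ^ (m + k))⁻¹) = t * q / f by field_simp,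
    show t * (q ^ (m + k))⁻¹ * q / (q ^ (m + k))⁻¹ = t * q by field_simp]
  rw [← eq_div_iff m1] at rb
  rw [← eq_div_iff m2] at rc
  rw [← eq_div_iff m3] at rd
  rw [← eq_div_iff m4] at rd'
  rw [← eq_div_iff k3] at re
  rw [← eq_div_iff k4] at rf
  rw [← eq_div_iff k2] at rq
  rw [← eq_div_iff k1] at rt
  rw [← eq_div_iff j1] at w2
  rw [rb, rc, rd, rd', re, rf, rq, rt, w2]
  have hp : (1 / (b / t)) ^ k * (1 / (c / t)) ^ k * (1 / (d / t)) ^ k * (1 / (d' / t)) ^ k =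
      q ^ k * (1 / (q / e)) ^ k * (1 / (q / f)) ^ k * (1 / q) ^ k * (1 / (q / t)) ^ k *
        (t ^ 3 * q ^ 3 / (b * c * d * d' * e * f)) ^ k := by
    simp only [← mul_pow]
    congr 1
    field_simp
  have n1 : (1 / (b / t)) ^ k ≠ 0 :=
    pow_ne_zero _ (one_div_ne_zero (div_ne_zero hb ht))
  have n2 : (1 / (c / t)) ^ k ≠ 0 :=
    pow_ne_zero _ (one_div_ne_zero (div_ne_zero hc ht))
  have n3 : (1 / (d / t)) ^ k ≠ 0 :=
    pow_ne_zero _ (one_div_ne_zero (div_ne_zero hd ht))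
  have n4 : (1 / (d' / t)) ^ k ≠ 0 :=
    pow_ne_zero _ (one_div_ne_zero (div_ne_zero hd' ht))
  generalize (1 / (b / t)) ^ k = p1 at *
  generalize (1 / (c / t)) ^ k = p2 at *
  generalize (1 / (d / t)) ^ k = p3 at *
  generalize (1 / (d' / t)) ^ k = p4 at *
  generalize (1 / (q / e)) ^ k = p5 at *
  generalize (1 / (q / f)) ^ k = p6 at *
  generalize (1 / (q / t)) ^ k = p7 at *
  generalize (1 / q) ^ k = p8 at *
  generalize (t ^ 3 * q ^ 3 / (b * c * d * d' * e * f)) ^ k = p9 at *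
  generalize q ^ m - t * q ^ k = W
  generalize q ^ k = p10 at *
  generalize q ^ (m + k) - t = Y at *
  generalize revFactor q k m = ω at *
  clear rb rc rd rd' re rf rq rt hs w1 w2
  generalize qPoch q (b / t) (m + k) = x1 at *
  generalize qPoch q (c / t) (m + k) = x2 at *
  generalize qPoch q (d / t) (m + k) = x3 at *
  generalize qPoch q (d' / t) (m + k) = x4 at *
  generalize qPoch q (q / t) (m + k) = x5 at *
  generalize qPoch q (q / e) (m + k) = x6 at *
  generalize qPoch q (q / f) (m + k) = x7 at *
  generalize qPoch q q (m + k) = x8 at *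
  generalize qPoch q (b / t) m = y1 at *
  generalize qPoch q (c / t) m = y2 at *
  generalize qPoch q (d / t) m = y3 at *
  generalize qPoch q (d' / t) m = y4 at *
  generalize qPoch q (q / t) m = y5 at *
  generalize qPoch q (q / e) m = y6 at *
  generalize qPoch q (q / f) m = y7 at *
  generalize qPoch q q m = y8 at *
  generalize qPoch q q k = z1 at *
  generalize qPoch q (t * q) k = z2 at *
  generalize qPoch q (t * q / e) k = z3 at *
  generalize qPoch q (t * q / f) k = z4 at *
  generalize 1 - t = U at *
  field_simp
  linear_combination -(W * qPoch q b k * qPoch q c k * qPoch q d k * qPoch q d' k) * hp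

theorem qPochs_eq_zero {q : ℂ} {l : List ℂ} {x : ℂ} {k : ℕ} (hx : x ∈ l) (h : qPoch q x k = 0) :
    qPochs q l k = 0 := by
  rw [qPochs, List.prod_eq_zero_iff, List.mem_map]
  exact ⟨x, hx, h⟩

theorem vwpSeries_eq_sum {q : ℂ} (hq : q ≠ 0) (a u : ℂ) {l : List ℂ} {n : ℕ}
    (h : (q ^ n)⁻¹ ∈ l) :
    vwpSeries q a l u = ∑ k ∈ range (n + 1), (1 - a * q ^ (2 * k)) / (1 - a) *
      (qPochs q (a :: l) k / qPochs q (q :: l.map fun x => a * q / x) k * u ^ k) := by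
  rw [vwpSeries, tsum_eq_sum (s := range (n + 1))]
  · exact sum_congr rfl fun k _ => by ring
  · intro k hk
    rw [qPochs_eq_zero (List.mem_cons_of_mem a h) (qPoch_inv_pow_eq_zero hq (by simpa using hk))]
    simp

theorem vwpSeries_eq_a2Sum {q t e f b c d d' : ℂ} {K : ℕ} (h : A2Regular q t e f K)
    (hb : b ≠ 0) (hc : c ≠ 0) (hd : d ≠ 0) (hd' : d' ≠ 0)
    (hb1 : qPoch q (b / t) K ≠ 0) (hc1 : qPoch q (c / t) K ≠ 0)
    (hd1 : qPoch q (d / t) K ≠ 0) (hd1' : qPoch q (d' / t) K ≠ 0) :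
    qPochs q [b / t, c / t, d / t, d' / t] K / qPochs q [q, 1 / t, q / e, q / f] K *
      vwpSeries q (t * (q ^ K)⁻¹) [b, c, d, d', e * (q ^ K)⁻¹, f * (q ^ K)⁻¹, (q ^ K)⁻¹]
        (t ^ 3 * q ^ 3 / (b * c * d * d' * e * f)) = a2Sum q t e f b c d d' K := by
  rw [vwpSeries_eq_sum h.q_ne _ _ (n := K) (by simp), a2Sum, mul_sum,
    ← Finset.Nat.sum_antidiagonal_swap, Nat.sum_antidiagonal_eq_sum_range_succ_mk]
  refine sum_congr rfl fun k hk => ?_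
  obtain ⟨m, rfl⟩ : ∃ m, K = m + k := ⟨K - k, by have := mem_range.1 hk; omega⟩
  simp only [Prod.fst_swap, Prod.snd_swap, Nat.add_sub_cancel]
  simpa only [mul_assoc] using vwp_term_eq h hb hc hd hd' hb1 hc1 hd1 hd1'

/-- The parameters $tq/e$ and $eq^{-K}$ have product $a_0q$ with $a_0=tq^{-K}$, so each cancels the
other's denominator. -/
theorem vwpSeries_cancel {q t e f b c d : ℂ} {K : ℕ} (h : A2Regular q t e f K) :
    vwpSeries q (t * (q ^ K)⁻¹) [b, c, d, t * q / e, e * (q ^ K)⁻¹, f * (q ^ K)⁻¹, (q ^ K)⁻¹]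
        (t ^ 3 * q ^ 3 / (b * c * d * (t * q / e) * e * f)) =
      vwpSeries q (t * (q ^ K)⁻¹) [b, c, d, f * (q ^ K)⁻¹, (q ^ K)⁻¹]
        (t ^ 2 * q ^ 2 / (b * c * d * f)) := by
  have hq := h.q_ne
  have ht := h.t_ne
  have he := h.e_ne
  have hQ : q ^ K ≠ 0 := pow_ne_zero _ hq
  rw [vwpSeries_eq_sum hq _ _ (n := K) (by simp), vwpSeries_eq_sum hq _ _ (n := K) (by simp)]
  refine sum_congr rfl fun k hk => ?_
  obtain ⟨m, rfl⟩ : ∃ m, K = m + k := ⟨K - k, by have := mem_range.1 hk; omega⟩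
  have re := qPoch_reverse_of_eq (x := e * (q ^ (m + k))⁻¹) (y := q / e) hq
    (div_ne_zero hq he) k m (by field_simp)
  have h1 : qPoch q (e * (q ^ (m + k))⁻¹) k ≠ 0 := by
    refine left_ne_zero_of_mul (b := qPoch q (q / e) m) ?_
    rw [re]
    exact mul_ne_zero (mul_ne_zero (revFactor_ne_zero hq _ _) (pow_ne_zero _
      (one_div_ne_zero (div_ne_zero hq he)))) h.qe
  have h2 := (h.mono (Nat.le_add_left k m)).te
  rw [show t ^ 3 * q ^ 3 / (b * c * d * (t * q / e) * e * f) = t ^ 2 * q ^ 2 / (b * c * d * f) by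
    field_simp]
  congr 2
  simp only [qPochs, List.map_cons, List.map_nil, List.prod_cons, List.prod_nil, mul_one]
  rw [show t * (q ^ (m + k))⁻¹ * q / (e * (q ^ (m + k))⁻¹) = t * q / e by field_simp,
    show t * (q ^ (m + k))⁻¹ * q / (t * q / e) = e * (q ^ (m + k))⁻¹ by field_simp]
  generalize qPoch q (e * (q ^ (m + k))⁻¹) k = y at *
  generalize qPoch q (t * q / e) k = z at *
  symm
  rw [← mul_div_mul_right _ _ (mul_ne_zero h1 h2)]
  ring

/-! ### Duality of the parameters -/

/-- The substitution $(t,e,f)\mapsto(f/e,f/t,f)$ is an involution and permutes the nonvanishing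
conditions. -/
theorem A2Regular.dual {q t e f : ℂ} {K : ℕ} (h : A2Regular q t e f K) :
    A2Regular q (f / e) (f / t) f K := by
  have ht := h.t_ne
  have he := h.e_ne
  have hf := h.f_ne
  refine ⟨h.q_ne, div_ne_zero hf he, div_ne_zero hf ht, hf, h.qq, ?_, ?_, ?_, ?_, ?_, h.qf, ?_, ?_⟩
  · convert h.ef using 2; field_simp
  · convert h.fe using 2; field_simp
  · convert h.inv_t using 2; field_simp
  · convert h.tq using 2; field_simp
  · convert h.tf using 2; field_simp
  · convert h.te using 2; field_simp
  · convert h.qe using 2; field_simp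

theorem dualNum_eq {q t e f x : ℂ} (ht : t ≠ 0) (he : e ≠ 0) (hf : f ≠ 0) (hx : x ≠ 0) (i k : ℕ) :
    dualNum q t e f x i k = x ^ (i + k) * a2Num q (f / e) (t * q / (x * e)) i k := by
  have key (y : ℂ) (hy : y ≠ 0) (n : ℕ) : ∏ j ∈ range n, (x - t * q ^ (j + 1) / y) =
      x ^ n * qPoch q (t * q / (x * y)) n := by
    rw [qPoch, ← Finset.card_range n, ← Finset.prod_const, Finset.card_range,
      ← Finset.prod_mul_distrib]
    refine Finset.prod_congr rfl fun j _ => ?_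
    field_simp
    ring
  rw [dualNum, key f hf, key e he, a2Num, show t * q / (x * e) / (f / e) = t * q / (x * f) by
    field_simp, pow_add]
  ring

/-- Pulling $x^{i+k}$ out of each numerator shows that the dual series is of the original kind. The
polynomial form `dualNum` served the degree argument. -/
theorem dualSum_eq {q t e f b c d d' : ℂ} (ht : t ≠ 0) (he : e ≠ 0) (hf : f ≠ 0)
    (hb : b ≠ 0) (hc : c ≠ 0) (hd : d ≠ 0) (hd' : d' ≠ 0) (L : ℕ) :
    dualSum q t e f b c d d' L = eulerArg q t e f b c d d' ^ L *
      a2Sum q (f / e) (f / t) f (t * q / (b * e)) (t * q / (c * e)) (t * q / (d * e))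
        (t * q / (d' * e)) L := by
  simp only [dualSum, a2Sum, mul_sum]
  refine sum_congr rfl fun p hp => ?_
  rw [dualNum_eq ht he hf hb, dualNum_eq ht he hf hc, dualNum_eq ht he hf hd,
    dualNum_eq ht he hf hd', mem_antidiagonal.1 hp, eulerArg]
  simp only [mul_pow]
  ring

/-- The Euler transformation expressing the dual series through the original one. -/
theorem a2Sum_dual_eq_sum {q t e f b c d d' : ℂ} {L : ℕ} (h : A2Regular q t e f L)
    (hb : b ≠ 0) (hc : c ≠ 0) (hd : d ≠ 0) (hd' : d' ≠ 0) :
    a2Sum q (f / e) (f / t) f (t * q / (b * e)) (t * q / (c * e)) (t * q / (d * e))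
        (t * q / (d' * e)) L =
      ∑ p ∈ antidiagonal L, binomCoeff q (eulerArg q t e f b c d d')⁻¹ p.1 *
        ((eulerArg q t e f b c d d')⁻¹ ^ p.2 * a2Sum q t e f b c d d' p.2) := by
  have hq := h.q_ne
  have ht := h.t_ne
  have he := h.e_ne
  have hf := h.f_ne
  -- Duality inverts the Euler argument, and by `hinv` it is an involution on the numerator
  -- parameters as well.
  have hA : eulerArg q (f / e) (f / t) f (t * q / (b * e)) (t * q / (c * e)) (t * q / (d * e))
      (t * q / (d' * e)) = (eulerArg q t e f b c d d')⁻¹ := by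
    simp only [eulerArg]
    field_simp
  rw [euler_transformation h.dual, eulerSum, hA]
  refine sum_congr rfl fun p _ => ?_
  have hinv (x : ℂ) (hx : x ≠ 0) : f / e * q / (t * q / (x * e) * (f / t)) = x := by
    field_simp
  have h1 : f / (f / t) = t := by field_simp
  have h2 : f / (f / e) = e := by field_simp
  rw [dualSum_eq (by positivity) (by positivity) hf (by positivity) (by positivity)
    (by positivity) (by positivity), hA, hinv b hb, hinv c hc, hinv d hd, hinv d' hd', h1, h2]

/-! ### Watson's transformation -/

/-- The parameter dual to $tq/e$ is $1$, and $(1)_k=0$ for $k\ge1$, so only $(L,0)$ contributes. -/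
theorem dualSum_cancel {q t e f b c d : ℂ} {L : ℕ} (h : A2Regular q t e f L)
    (hb : b ≠ 0) (hc : c ≠ 0) (hd : d ≠ 0) :
    dualSum q t e f b c d (t * q / e) L = (b * c * d * f / (t ^ 2 * q)) ^ L *
      (qPochs q [t * q / (b * f), t * q / (c * f), t * q / (d * f)] L /
        qPochs q [q, t * q / f, q / f] L) := by
  have hq := h.q_ne
  have ht := h.t_ne
  have he := h.e_ne
  have hf := h.f_ne
  have hef := sub_ne_zero.2 h.e_ne_f
  have hA : eulerArg q t e f b c d (t * q / e) = b * c * d * f / (t ^ 2 * q) := by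
    rw [eulerArg]
    field_simp
  have hd' : t * q / e ≠ 0 := div_ne_zero (mul_ne_zero ht hq) he
  rw [dualSum_eq ht he hf hb hc hd hd', hA, a2Sum, sum_eq_single (L, 0)]
  · have h1 : t * q / (t * q / e * e) = 1 := by field_simp
    have hs := (qPoch_succ' q (e / f) L).symm.trans (qPoch_succ q (e / f) L)
    have hne := h.ef
    rw [qPoch_succ'] at hne
    have n1 := right_ne_zero_of_mul hne
    have n2 := left_ne_zero_of_mul hne
    have n3 := h.qq
    have n4 := h.tf
    have n5 := h.qf
    have n6 : 1 - f / e ≠ 0 := by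
      rw [show 1 - f / e = (e - f) / e by field_simp]
      exact div_ne_zero hef he
    have hs' : qPoch q (e / f) L * (q ^ L - f / e) =
        (1 - f / e) * qPoch q (e / f * q) L := by
      field_simp at hs ⊢
      linear_combination hs
    simp only [a2Weight, a2Num, qPoch_zero, mul_one, qPochs, List.map_cons, List.map_nil,
      List.prod_cons, List.prod_nil, h1, pow_zero]
    rw [show t * q / (b * e) / (f / e) = t * q / (b * f) by field_simp,
      show t * q / (c * e) / (f / e) = t * q / (c * f) by field_simp,
      show t * q / (d * e) / (f / e) = t * q / (d * f) by field_simp,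
      show 1 / (f / e) = e / f by field_simp, show q / (f / e) = e / f * q by field_simp,
      show q / (f / t) = t * q / f by field_simp]
    congr 1
    generalize qPoch q (t * q / (b * f)) L = u1
    generalize qPoch q (t * q / (c * f)) L = u2
    generalize qPoch q (t * q / (d * f)) L = u3
    generalize qPoch q (e / f * q) L = x1 at *
    generalize qPoch q (e / f) L = x2 at *
    generalize qPoch q (t * q / f) L = x3 at *
    generalize qPoch q (q / f) L = x4 at *
    generalize 1 - f / e = y at *
    generalize q ^ L - f / e = z at *
    field_simp
    linear_combination u1 * u2 * u3 * hs'
  · rintro ⟨i, k⟩ hp hne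
    rcases k with _ | k
    · have := mem_antidiagonal.1 hp
      exact absurd (by simpa using this) hne
    · have h1 : t * q / (t * q / e * e) = 1 := by field_simp
      have : a2Num q (f / e) (t * q / (t * q / e * e)) i (k + 1) = 0 := by
        rw [h1, a2Num, qPoch_succ' q 1]
        ring
      rw [this]
      ring
  · simp

/-- Watson's transformation does not contain $e$. It is an auxiliary parameter, and only finitely
many values are forbidden. -/
theorem exists_a2Regular {q t f : ℂ} {K : ℕ} (hq : q ≠ 0) (ht : t ≠ 0) (hf : f ≠ 0)
    (hqq : qPoch q q K ≠ 0) (hinv : qPoch q (1 / t) (K + 1) ≠ 0) (htq : qPoch q (t * q) K ≠ 0)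
    (hqf : qPoch q (q / f) K ≠ 0) (htf : qPoch q (t * q / f) K ≠ 0) :
    ∃ e, A2Regular q t e f K := by
  obtain ⟨e, he⟩ := Infinite.exists_notMem_finset
    ({0} ∪ ((range (K + 1)).image (fun j => f * (q ^ j)⁻¹) ∪
      ((range K).image (fun j => f * q * q ^ j) ∪ ((range K).image (fun j => q * q ^ j) ∪
        (range K).image (fun j => t * q * q ^ j)))) : Finset ℂ)
  simp only [mem_union, mem_singleton, mem_image, mem_range, not_or, not_exists, not_and] at he
  obtain ⟨h0, h1, h2, h3, h4⟩ := he
  have aux (x : ℂ) (hx : ∀ j < K, ¬x * q ^ j = e) : qPoch q (x / e) K ≠ 0 := by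
    refine qPoch_ne_zero_iff.2 fun j hj h => hx j hj ?_
    field_simp at h
    linear_combination -h
  refine ⟨e, hq, ht, h0, hf, hqq, hinv, htq, qPoch_ne_zero_iff.2 fun j hj h => h1 j hj ?_,
    aux _ h2, aux _ h3, hqf, aux _ h4, htf⟩
  have := pow_ne_zero j hq
  field_simp at h ⊢
  linear_combination h

/-- Watson's transformation of a terminating very-well-poised `₈W₇` series. -/
theorem watson {q t f b c d : ℂ} {K : ℕ} (hq : q ≠ 0) (ht : t ≠ 0) (hf : f ≠ 0)
    (hb : b ≠ 0) (hc : c ≠ 0) (hd : d ≠ 0)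
    (hqq : qPoch q q K ≠ 0) (hinv : qPoch q (1 / t) (K + 1) ≠ 0) (htq : qPoch q (t * q) K ≠ 0)
    (hqf : qPoch q (q / f) K ≠ 0) (htf : qPoch q (t * q / f) K ≠ 0)
    (hb1 : qPoch q (b / t) K ≠ 0) (hc1 : qPoch q (c / t) K ≠ 0) (hd1 : qPoch q (d / t) K ≠ 0) :
    qPochs q [b / t, c / t, d / t] K / qPochs q [q, 1 / t, q / f] K *
      vwpSeries q (t * (q ^ K)⁻¹) [b, c, d, f * (q ^ K)⁻¹, (q ^ K)⁻¹]
        (t ^ 2 * q ^ 2 / (b * c * d * f)) =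
    ∑ p ∈ antidiagonal K, binomCoeff q (b * c * d * f / (t ^ 2 * q)) p.1 *
      ((b * c * d * f / (t ^ 2 * q)) ^ p.2 *
        (qPochs q [t * q / (b * f), t * q / (c * f), t * q / (d * f)] p.2 /
          qPochs q [q, t * q / f, q / f] p.2)) := by
  obtain ⟨e, h⟩ := exists_a2Regular hq ht hf hqq hinv htq hqf htf
  have he := h.e_ne
  have h1 : t * q / e / t = q / e := by field_simp
  have key := vwpSeries_eq_a2Sum h hb hc hd (div_ne_zero (mul_ne_zero ht hq) he) hb1 hc1 hd1
    (by rw [h1]; exact h.qe)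
  have hA : eulerArg q t e f b c d (t * q / e) = b * c * d * f / (t ^ 2 * q) := by
    rw [eulerArg]
    field_simp
  rw [vwpSeries_cancel h, euler_transformation h, eulerSum, hA, h1] at key
  convert key using 1
  · congr 1
    have := h.qe
    simp only [qPochs, List.map_cons, List.map_nil, List.prod_cons, List.prod_nil, mul_one]
    generalize qPoch q (q / e) K = x at *
    rw [← mul_div_mul_right _ (qPoch q q K * _) this]
    ring
  · refine sum_congr rfl fun p hp => ?_
    rw [dualSum_cancel (h.mono (by have := mem_antidiagonal.1 hp; omega)) hb hc hd]

/-! ### Watson's transformation with shifted base -/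

theorem revFactor_zero_right_mul (q : ℂ) (m k : ℕ) :
    revFactor q m k * revFactor q k 0 = revFactor q (k + m) 0 := by
  simp only [revFactor, prod_range_add, zero_add]
  ring

theorem revFactor_mul_pow {q : ℂ} (hq : q ≠ 0) (k m : ℕ) :
    revFactor q k m * q ^ (m * k) = revFactor q k 0 := by
  induction k with
  | zero => simp [revFactor]
  | succ k ih =>
    rw [revFactor, revFactor, prod_range_succ, prod_range_succ, ← revFactor, ← revFactor, ← ih]
    field_simp
    ring

theorem revFactor_sq {q : ℂ} (hq : q ≠ 0) (n : ℕ) :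
    revFactor q n 0 ^ 2 * q ^ (n * n) = q ^ n := by
  induction n with
  | zero => simp [revFactor]
  | succ n ih =>
    rw [revFactor, prod_range_succ, ← revFactor, pow_succ q n, ← ih]
    field_simp
    ring

/-- In closed form `revFactor q k m` is $(-1)^kq^{-km-k(k-1)/2}$; this compares signs and quadratic
exponents. -/
theorem revFactor_swap {q : ℂ} (hq : q ≠ 0) (m k : ℕ) :
    revFactor q m k = revFactor q (k + m) 0 * revFactor q k m * (q ^ (k * (k + m)) / q ^ k) := by
  have h1 := revFactor_zero_right_mul q m k
  have h2 := revFactor_mul_pow hq k m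
  have h3 := revFactor_sq hq k
  have h4 : q ^ k ≠ 0 := pow_ne_zero _ hq
  rw [mul_div_assoc', eq_div_iff h4, ← h1, mul_add, pow_add, ← h3, ← h2]
  ring

/-- With $N=K+M$, reversal converts factorials of length $M$ into ones of length $K$ and $N$. This
brings the prefactor of `watson` to the shape of the $K$-th summand of the theorem. -/
theorem watson_prefactor {q σ φ β δ₁ δ₂ : ℂ} {K M : ℕ} (hq : q ≠ 0) (hσ : σ ≠ 0) (hφ : φ ≠ 0)
    (hβ : β ≠ 0) (hδ₁ : δ₁ ≠ 0) (hδ₂ : δ₂ ≠ 0) (hqq : qPoch q q (K + M) ≠ 0)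
    (hs : qPoch q (σ * q) (K + M) ≠ 0) (hφ1 : qPoch q φ (K + M) ≠ 0)
    (h1 : qPoch q (σ * q / β) (K + M) ≠ 0) (h2 : qPoch q (σ * q / δ₁) (K + M) ≠ 0)
    (h3 : qPoch q (σ * q / δ₂) (K + M) ≠ 0) :
    qPochs q [β / (σ * q ^ (K + M)), δ₁ / (σ * q ^ (K + M)), δ₂ / (σ * q ^ (K + M))] M /
        qPochs q [q, 1 / (σ * q ^ (K + M)), q / (φ * q ^ (K + M))] M =
      qPochs q [σ * q, φ, (q ^ (K + M))⁻¹] K / qPochs q [σ * q / β, σ * q / δ₁, σ * q / δ₂] K *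
        q ^ K * (qPochs q [σ * q / β, σ * q / δ₁, σ * q / δ₂] (K + M) /
          qPochs q [σ * q, φ, q] (K + M)) * (revFactor q (K + M) 0 *
            (q ^ (K * (K + M)) / q ^ K) * (β * δ₁ * δ₂ * φ / (σ ^ 2 * q ^ 2)) ^ M) := by
  have hσq : σ * q ≠ 0 := mul_ne_zero hσ hq
  have r1 := qPoch_reverse_of_eq (x := β / (σ * q ^ (K + M))) (y := σ * q / β) hq
    (div_ne_zero hσq hβ) M K (by field_simp)
  have r2 := qPoch_reverse_of_eq (x := δ₁ / (σ * q ^ (K + M))) (y := σ * q / δ₁) hq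
    (div_ne_zero hσq hδ₁) M K (by field_simp)
  have r3 := qPoch_reverse_of_eq (x := δ₂ / (σ * q ^ (K + M))) (y := σ * q / δ₂) hq
    (div_ne_zero hσq hδ₂) M K (by field_simp)
  have r4 := qPoch_reverse_of_eq (x := 1 / (σ * q ^ (K + M))) (y := σ * q) hq
    hσq M K (by field_simp)
  have r5 := qPoch_reverse_of_eq (x := q / (φ * q ^ (K + M))) (y := φ) hq hφ M K (by field_simp)
  have r6 := qPoch_reverse_of_eq (x := (q ^ (M + K))⁻¹) (y := q) hq hq K M (by field_simp)
  rw [add_comm M K] at r6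
  have l0 := qPoch_ne_zero_mono hqq (Nat.le_add_left M K)
  have l1 := qPoch_ne_zero_mono h1 (Nat.le_add_right K M)
  have l2 := qPoch_ne_zero_mono h2 (Nat.le_add_right K M)
  have l3 := qPoch_ne_zero_mono h3 (Nat.le_add_right K M)
  have l4 := qPoch_ne_zero_mono hs (Nat.le_add_right K M)
  have l5 := qPoch_ne_zero_mono hφ1 (Nat.le_add_right K M)
  rw [← eq_div_iff l1] at r1
  rw [← eq_div_iff l2] at r2
  rw [← eq_div_iff l3] at r3
  rw [← eq_div_iff l4] at r4
  rw [← eq_div_iff l5] at r5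
  rw [← eq_div_iff l0] at r6
  simp only [qPochs, List.map_cons, List.map_nil, List.prod_cons, List.prod_nil, mul_one]
  rw [r1, r2, r3, r4, r5, r6]
  have hω := revFactor_ne_zero hq M K
  have hω' := revFactor_ne_zero hq K M
  have hsw := revFactor_swap hq M K
  have hp : (1 / (σ * q / β)) ^ M * (1 / (σ * q / δ₁)) ^ M * (1 / (σ * q / δ₂)) ^ M =
      (1 / (σ * q)) ^ M * (1 / φ) ^ M * (β * δ₁ * δ₂ * φ / (σ ^ 2 * q ^ 2)) ^ M := by
    simp only [← mul_pow]
    congr 1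
    field_simp
  have n4 : (1 / (σ * q)) ^ M ≠ 0 := pow_ne_zero _ (one_div_ne_zero hσq)
  have n5 : (1 / φ) ^ M ≠ 0 := pow_ne_zero _ (one_div_ne_zero hφ)
  have n6 : (1 / q) ^ K * q ^ K = 1 := by rw [← mul_pow, one_div_mul_cancel hq, one_pow]
  have n7 : (1 / q) ^ K ≠ 0 := pow_ne_zero _ (one_div_ne_zero hq)
  generalize (1 / (σ * q / β)) ^ M = p1 at *
  generalize (1 / (σ * q / δ₁)) ^ M = p2 at *
  generalize (1 / (σ * q / δ₂)) ^ M = p3 at *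
  generalize (1 / (σ * q)) ^ M = p4 at *
  generalize (1 / φ) ^ M = p5 at *
  generalize (β * δ₁ * δ₂ * φ / (σ ^ 2 * q ^ 2)) ^ M = p6 at *
  generalize (1 / q) ^ K = p7 at *
  generalize q ^ (K * (K + M)) / q ^ K = p8 at *
  generalize q ^ K = p9 at *
  generalize revFactor q M K = w1 at *
  generalize revFactor q K M = w2 at *
  generalize revFactor q (K + M) 0 = w3 at *
  clear r1 r2 r3 r4 r5 r6
  generalize qPoch q (σ * q / β) (K + M) = x1 at *
  generalize qPoch q (σ * q / δ₁) (K + M) = x2 at *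
  generalize qPoch q (σ * q / δ₂) (K + M) = x3 at *
  generalize qPoch q (σ * q) (K + M) = x4 at *
  generalize qPoch q φ (K + M) = x5 at *
  generalize qPoch q q (K + M) = x6 at *
  generalize qPoch q (σ * q / β) K = y1 at *
  generalize qPoch q (σ * q / δ₁) K = y2 at *
  generalize qPoch q (σ * q / δ₂) K = y3 at *
  generalize qPoch q (σ * q) K = y4 at *
  generalize qPoch q φ K = y5 at *
  generalize qPoch q q M = y6 at *
  field_simp
  linear_combination w1 * hp + p4 * p5 * p6 * hsw - p4 * p5 * p6 * w2 * w3 * p8 * n6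

/-- The same reversal for the summands on the other side, with $l+L=N$. It produces the summand
$G(l)$ of the right-hand side, to be used with $l=K+j$. -/
theorem watson_summand {q σ φ β δ₁ δ₂ : ℂ} {l L : ℕ} (hq : q ≠ 0) (hσ : σ ≠ 0) (hφ : φ ≠ 0)
    (hβ : β ≠ 0) (hδ₁ : δ₁ ≠ 0) (hδ₂ : δ₂ ≠ 0) (hqq : qPoch q q (l + L) ≠ 0)
    (hs : qPoch q (σ * q / φ) (l + L) ≠ 0) (hφ1 : qPoch q φ (l + L) ≠ 0)
    (h1 : qPoch q (σ * q / (β * φ)) (l + L) ≠ 0) (h2 : qPoch q (σ * q / (δ₁ * φ)) (l + L) ≠ 0)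
    (h3 : qPoch q (σ * q / (δ₂ * φ)) (l + L) ≠ 0) :
    qPochs q [σ * q / (β * φ), σ * q / (δ₁ * φ), σ * q / (δ₂ * φ)] L /
        qPochs q [q, σ * q / φ, q / (φ * q ^ (l + L))] L * (revFactor q (l + L) 0 *
            (q ^ (l * (l + L)) / q ^ l)) =
      qPochs q [(q ^ (l + L))⁻¹ * φ / σ, φ, (q ^ (l + L))⁻¹] l /
        qPochs q [(q ^ (l + L))⁻¹ * φ * β / σ, (q ^ (l + L))⁻¹ * δ₁ * φ / σ,
          (q ^ (l + L))⁻¹ * δ₂ * φ / σ] l * q ^ l * φ ^ (l + L) *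
      (qPochs q [σ * q / (β * φ), σ * q / (δ₁ * φ), σ * q / (δ₂ * φ)] (l + L) /
          qPochs q [q, σ * q / φ, φ] (l + L)) * (β * δ₁ * δ₂ * φ / (σ ^ 2 * q ^ 2)) ^ l := by
  have hσq : σ * q ≠ 0 := mul_ne_zero hσ hq
  have r1 := qPoch_reverse_of_eq (x := (q ^ (L + l))⁻¹ * φ * β / σ) (y := σ * q / (β * φ)) hq
    (div_ne_zero hσq (mul_ne_zero hβ hφ)) l L (by field_simp)
  have r2 := qPoch_reverse_of_eq (x := (q ^ (L + l))⁻¹ * δ₁ * φ / σ) (y := σ * q / (δ₁ * φ)) hq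
    (div_ne_zero hσq (mul_ne_zero hδ₁ hφ)) l L (by field_simp)
  have r3 := qPoch_reverse_of_eq (x := (q ^ (L + l))⁻¹ * δ₂ * φ / σ) (y := σ * q / (δ₂ * φ)) hq
    (div_ne_zero hσq (mul_ne_zero hδ₂ hφ)) l L (by field_simp)
  have r4 := qPoch_reverse_of_eq (x := (q ^ (L + l))⁻¹ * φ / σ) (y := σ * q / φ) hq
    (div_ne_zero hσq hφ) l L (by field_simp)
  have r5 := qPoch_reverse_of_eq (x := q / (φ * q ^ (l + L))) (y := φ) hq hφ L l (by field_simp)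
  have r6 := qPoch_reverse_of_eq (x := (q ^ (L + l))⁻¹) (y := q) hq hq l L (by field_simp)
  rw [add_comm L l] at r1 r2 r3 r4 r6
  have hω := revFactor_ne_zero hq L l
  have hω' := revFactor_ne_zero hq l L
  have hsw := revFactor_swap hq L l
  have o4 : (1 / (σ * q / φ)) ^ l ≠ 0 := pow_ne_zero _ (one_div_ne_zero (div_ne_zero hσq hφ))
  have o1 : (1 / (σ * q / (β * φ))) ^ l ≠ 0 :=
    pow_ne_zero _ (one_div_ne_zero (div_ne_zero hσq (mul_ne_zero hβ hφ)))
  have o2 : (1 / (σ * q / (δ₁ * φ))) ^ l ≠ 0 :=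
    pow_ne_zero _ (one_div_ne_zero (div_ne_zero hσq (mul_ne_zero hδ₁ hφ)))
  have o3 : (1 / (σ * q / (δ₂ * φ))) ^ l ≠ 0 :=
    pow_ne_zero _ (one_div_ne_zero (div_ne_zero hσq (mul_ne_zero hδ₂ hφ)))
  have o5 : (1 / φ) ^ L ≠ 0 := pow_ne_zero _ (one_div_ne_zero hφ)
  have hp : (1 / (σ * q / (β * φ))) ^ l * (1 / (σ * q / (δ₁ * φ))) ^ l *
      (1 / (σ * q / (δ₂ * φ))) ^ l =
      (1 / (σ * q / φ)) ^ l * (1 / q) ^ l * (q ^ l * (φ ^ l *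
        (β * δ₁ * δ₂ * φ / (σ ^ 2 * q ^ 2)) ^ l)) := by
    simp only [← mul_pow]
    congr 1
    field_simp
  have o6 : (1 / q) ^ l * q ^ l = 1 := by rw [← mul_pow, one_div_mul_cancel hq, one_pow]
  have o7 : (1 / φ) ^ L * φ ^ L = 1 := by rw [← mul_pow, one_div_mul_cancel hφ, one_pow]
  have o8 : φ ^ L ≠ 0 := pow_ne_zero _ hφ
  have l0 := qPoch_ne_zero_mono hqq (Nat.le_add_left L l)
  have l1 := qPoch_ne_zero_mono h1 (Nat.le_add_left L l)
  have l2 := qPoch_ne_zero_mono h2 (Nat.le_add_left L l)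
  have l3 := qPoch_ne_zero_mono h3 (Nat.le_add_left L l)
  have l4 := qPoch_ne_zero_mono hs (Nat.le_add_left L l)
  have l5 := qPoch_ne_zero_mono hφ1 (Nat.le_add_right l L)
  rw [← eq_div_iff l1] at r1
  rw [← eq_div_iff l2] at r2
  rw [← eq_div_iff l3] at r3
  rw [← eq_div_iff l4] at r4
  rw [← eq_div_iff l5] at r5
  rw [← eq_div_iff l0] at r6
  simp only [qPochs, List.map_cons, List.map_nil, List.prod_cons, List.prod_nil, mul_one]
  rw [r1, r2, r3, r4, r5, r6, pow_add φ]
  generalize (1 / (σ * q / (β * φ))) ^ l = p1 at *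
  generalize (1 / (σ * q / (δ₁ * φ))) ^ l = p2 at *
  generalize (1 / (σ * q / (δ₂ * φ))) ^ l = p3 at *
  generalize (1 / (σ * q / φ)) ^ l = p4 at *
  generalize (1 / φ) ^ L = p5 at *
  generalize (β * δ₁ * δ₂ * φ / (σ ^ 2 * q ^ 2)) ^ l = p6 at *
  generalize (1 / q) ^ l = p7 at *
  generalize q ^ (l * (l + L)) / q ^ l = p8 at *
  generalize q ^ l = p9 at *
  generalize φ ^ l = p10 at *
  generalize φ ^ L = p11 at *
  generalize revFactor q L l = w1 at *
  generalize revFactor q l L = w2 at *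
  generalize revFactor q (l + L) 0 = w3 at *
  clear r1 r2 r3 r4 r5 r6
  generalize qPoch q (σ * q / (β * φ)) (l + L) = x1 at *
  generalize qPoch q (σ * q / (δ₁ * φ)) (l + L) = x2 at *
  generalize qPoch q (σ * q / (δ₂ * φ)) (l + L) = x3 at *
  generalize qPoch q (σ * q / φ) (l + L) = x4 at *
  generalize qPoch q φ (l + L) = x5 at *
  generalize qPoch q q (l + L) = x6 at *
  generalize qPoch q (σ * q / (β * φ)) L = y1 at *
  generalize qPoch q (σ * q / (δ₁ * φ)) L = y2 at *
  generalize qPoch q (σ * q / (δ₂ * φ)) L = y3 at *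
  generalize qPoch q (σ * q / φ) L = y4 at *
  generalize qPoch q φ l = y5 at *
  generalize qPoch q q L = y6 at *
  field_simp
  linear_combination w3 * p8 * w2 * hp - p4 * p7 * p9 * p10 * p6 * hsw -
    p4 * p7 * p9 * p10 * p6 * w1 * o7

theorem qPoch_reverse_ne_zero {q x y : ℂ} (hq : q ≠ 0) (hy : y ≠ 0) {k m : ℕ}
    (hx : x * (y * q ^ (m + k)) = q) (h : qPoch q y (m + k) ≠ 0) : qPoch q x k ≠ 0 := by
  refine left_ne_zero_of_mul (b := qPoch q y m) ?_
  rw [qPoch_reverse_of_eq hq hy k m hx]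
  exact mul_ne_zero (mul_ne_zero (revFactor_ne_zero hq _ _) (pow_ne_zero _ (one_div_ne_zero hy))) h

/-- Watson's transformation for the `₈W₇` series with base `σ q^K`, for generic `φ`. -/
theorem watson_shifted_of_ne {q σ φ β δ₁ δ₂ : ℂ} {K M : ℕ} (hq : q ≠ 0) (hσ : σ ≠ 0) (hφ : φ ≠ 0)
    (hβ : β ≠ 0) (hδ₁ : δ₁ ≠ 0) (hδ₂ : δ₂ ≠ 0) (hqq : qPoch q q (K + M) ≠ 0)
    (hs : qPoch q σ (2 * (K + M) + 1) ≠ 0) (hφ1 : qPoch q φ (K + M) ≠ 0)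
    (h1 : qPoch q (σ * q / β) (K + M) ≠ 0) (h2 : qPoch q (σ * q / δ₁) (K + M) ≠ 0)
    (h3 : qPoch q (σ * q / δ₂) (K + M) ≠ 0) (h4 : qPoch q (σ * q / φ) (K + M) ≠ 0)
    (h5 : qPoch q (σ * q / (β * φ)) (K + M) ≠ 0) (h6 : qPoch q (σ * q / (δ₁ * φ)) (K + M) ≠ 0)
    (h7 : qPoch q (σ * q / (δ₂ * φ)) (K + M) ≠ 0) :
    qPochs q [σ * q, φ, (q ^ (K + M))⁻¹] K / qPochs q [σ * q / β, σ * q / δ₁, σ * q / δ₂] K *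
        q ^ K * vwpSeries q (σ * q ^ K) [β, δ₁, δ₂, φ * q ^ K, (q ^ M)⁻¹]
          (σ ^ 2 * q ^ (K + M + 2) / (β * δ₁ * δ₂ * φ)) =
      φ ^ (K + M) * (qPochs q [σ * q, σ * q / (β * φ), σ * q / (δ₁ * φ), σ * q / (δ₂ * φ)] (K + M) /
        qPochs q [σ * q / β, σ * q / φ, σ * q / δ₁, σ * q / δ₂] (K + M)) *
      ((β * δ₁ * δ₂ * φ / (σ ^ 2 * q ^ (K + M + 1))) ^ K * ∑ p ∈ antidiagonal M,
        binomCoeff q (β * δ₁ * δ₂ * φ / (σ ^ 2 * q ^ (K + M + 1))) p.1 *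
        (qPochs q [(q ^ (K + M))⁻¹ * φ / σ, φ, (q ^ (K + M))⁻¹] (K + p.1) /
        qPochs q [(q ^ (K + M))⁻¹ * φ * β / σ, (q ^ (K + M))⁻¹ * δ₁ * φ / σ,
          (q ^ (K + M))⁻¹ * δ₂ * φ / σ] (K + p.1) * q ^ (K + p.1))) := by
  have hQ : q ^ (K + M) ≠ 0 := pow_ne_zero _ hq
  have hσq : σ * q ≠ 0 := mul_ne_zero hσ hq
  have hsq : qPoch q (σ * q) (K + M) ≠ 0 := by
    rw [qPoch_succ'] at hs
    exact qPoch_ne_zero_mono (right_ne_zero_of_mul hs) (by omega)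
  -- Degree $M$ with $t=\sigma q^N$, $f=\varphi q^N$, $N=K+M$, so that $tq^{-M}=\sigma q^K$ and
  -- $fq^{-M}=\varphi q^K$. The conditions on $(1/t)_{M+1}$ and $(tq)_M$ concern $1-\sigma q^{N-j}$
  -- and $1-\sigma q^{N+1+j}$, all covered by $(\sigma)_{2N+1}$.
  have key := watson (K := M) (t := σ * q ^ (K + M)) (f := φ * q ^ (K + M)) hq
    (mul_ne_zero hσ hQ) (mul_ne_zero hφ hQ) hβ hδ₁ hδ₂
    (qPoch_ne_zero_mono hqq (Nat.le_add_left M K))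
    (by
      refine qPoch_ne_zero_iff.2 fun j hj h => qPoch_ne_zero_iff.1 hs (K + M - j) (by omega) ?_
      rw [show q ^ (K + M) = q ^ (K + M - j) * q ^ j by rw [← pow_add]; congr 1; omega] at h
      have := pow_ne_zero j hq
      have := pow_ne_zero (K + M - j) hq
      field_simp at h
      linear_combination -h)
    (by
      refine qPoch_ne_zero_iff.2 fun j hj => ?_
      have := qPoch_ne_zero_iff.1 hs (K + M + 1 + j) (by omega)
      rwa [pow_add, pow_add, pow_one, ← mul_assoc, ← mul_assoc] at this)
    (qPoch_reverse_ne_zero (m := K) hq hφ (by field_simp) hφ1)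
    (by
      rw [show σ * q ^ (K + M) * q / (φ * q ^ (K + M)) = σ * q / φ by field_simp]
      exact qPoch_ne_zero_mono h4 (Nat.le_add_left M K))
    (qPoch_reverse_ne_zero (m := K) hq (div_ne_zero hσq hβ) (by field_simp) h1)
    (qPoch_reverse_ne_zero (m := K) hq (div_ne_zero hσq hδ₁) (by field_simp) h2)
    (qPoch_reverse_ne_zero (m := K) hq (div_ne_zero hσq hδ₂) (by field_simp) h3)
  rw [watson_prefactor hq hσ hφ hβ hδ₁ hδ₂ hqq hsq hφ1 h1 h2 h3] at key
  have a1 : σ * q ^ (K + M) * (q ^ M)⁻¹ = σ * q ^ K := by rw [pow_add]; field_simp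
  have a2 : φ * q ^ (K + M) * (q ^ M)⁻¹ = φ * q ^ K := by rw [pow_add]; field_simp
  have a3 : (σ * q ^ (K + M)) ^ 2 * q ^ 2 / (β * δ₁ * δ₂ * (φ * q ^ (K + M))) =
      σ ^ 2 * q ^ (K + M + 2) / (β * δ₁ * δ₂ * φ) := by rw [pow_add q (K + M)]; field_simp
  have a4 : β * δ₁ * δ₂ * (φ * q ^ (K + M)) / ((σ * q ^ (K + M)) ^ 2 * q) =
      β * δ₁ * δ₂ * φ / (σ ^ 2 * q ^ (K + M + 1)) := by rw [pow_add q (K + M)]; field_simp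
  have a5 (x : ℂ) : σ * q ^ (K + M) * q / (x * (φ * q ^ (K + M))) = σ * q / (x * φ) := by
    rw [← mul_assoc x, mul_right_comm σ, mul_div_mul_right _ _ hQ]
  have a6 : σ * q ^ (K + M) * q / (φ * q ^ (K + M)) = σ * q / φ := by
    rw [mul_right_comm σ, mul_div_mul_right _ _ hQ]
  rw [a1, a2, a3, a4, a5, a5, a5, a6] at key
  have hY (n : ℕ) : (β * δ₁ * δ₂ * φ / (σ ^ 2 * q ^ 2)) ^ n =
      (β * δ₁ * δ₂ * φ / (σ ^ 2 * q ^ (K + M + 1))) ^ n * (q ^ (n * (K + M)) / q ^ n) := by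
    rw [show β * δ₁ * δ₂ * φ / (σ ^ 2 * q ^ 2) =
      β * δ₁ * δ₂ * φ / (σ ^ 2 * q ^ (K + M + 1)) * (q ^ (K + M) / q) by
        rw [pow_succ q (K + M)]; field_simp, mul_pow, div_pow (q ^ (K + M)), ← pow_mul,
      mul_comm (K + M) n]
  have hΩ := revFactor_sq hq (K + M)
  have hΩ0 := revFactor_ne_zero hq (K + M) 0
  have hB0 : β * δ₁ * δ₂ * φ / (σ ^ 2 * q ^ (K + M + 1)) ≠ 0 :=
    div_ne_zero (by positivity) (mul_ne_zero (pow_ne_zero _ hσ) (pow_ne_zero _ hq))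
  have hterm : ∀ p ∈ antidiagonal M,
      binomCoeff q (β * δ₁ * δ₂ * φ / (σ ^ 2 * q ^ (K + M + 1))) p.1 *
      ((β * δ₁ * δ₂ * φ / (σ ^ 2 * q ^ (K + M + 1))) ^ p.2 *
        (qPochs q [σ * q / (β * φ), σ * q / (δ₁ * φ), σ * q / (δ₂ * φ)] p.2 /
          qPochs q [q, σ * q / φ, q / (φ * q ^ (K + M))] p.2)) =
      (qPochs q [σ * q / β, σ * q / δ₁, σ * q / δ₂] (K + M) /
          qPochs q [σ * q, φ, q] (K + M)) * (revFactor q (K + M) 0 *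
            (q ^ (K * (K + M)) / q ^ K) * (β * δ₁ * δ₂ * φ / (σ ^ 2 * q ^ 2)) ^ M) *
      (φ ^ (K + M) * (qPochs q [σ * q, σ * q / (β * φ), σ * q / (δ₁ * φ), σ * q / (δ₂ * φ)]
        (K + M) / qPochs q [σ * q / β, σ * q / φ, σ * q / δ₁, σ * q / δ₂] (K + M)) *
      (β * δ₁ * δ₂ * φ / (σ ^ 2 * q ^ (K + M + 1))) ^ K) * (
        binomCoeff q (β * δ₁ * δ₂ * φ / (σ ^ 2 * q ^ (K + M + 1))) p.1 *
        (qPochs q [(q ^ (K + M))⁻¹ * φ / σ, φ, (q ^ (K + M))⁻¹] (K + p.1) /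
        qPochs q [(q ^ (K + M))⁻¹ * φ * β / σ, (q ^ (K + M))⁻¹ * δ₁ * φ / σ,
          (q ^ (K + M))⁻¹ * δ₂ * φ / σ] (K + p.1) * q ^ (K + p.1))) := by
    rintro ⟨j, L⟩ hp
    simp only
    have hN : K + M = K + j + L := by rw [← mem_antidiagonal.1 hp]; ring
    have hX := watson_summand (l := K + j) (L := L) hq hσ hφ hβ hδ₁ hδ₂ (hN ▸ hqq) (hN ▸ h4)
      (hN ▸ hφ1) (hN ▸ h5) (hN ▸ h6) (hN ▸ h7)
    rw [← hN, hY] at hX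
    rw [hY]
    have hpl : q ^ ((K + j) * (K + M)) / q ^ (K + j) ≠ 0 :=
      div_ne_zero (pow_ne_zero _ hq) (pow_ne_zero _ hq)
    have hpp : q ^ (K * (K + M)) / q ^ K * (q ^ (M * (K + M)) / q ^ M) *
        revFactor q (K + M) 0 ^ 2 = 1 := by
      rw [div_mul_div_comm, ← pow_add, ← pow_add, ← add_mul, div_mul_eq_mul_div, mul_comm, hΩ,
        div_self hQ]
    have hA : (β * δ₁ * δ₂ * φ / (σ ^ 2 * q ^ (K + M + 1))) ^ L *
        (β * δ₁ * δ₂ * φ / (σ ^ 2 * q ^ (K + M + 1))) ^ (K + j) =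
        (β * δ₁ * δ₂ * φ / (σ ^ 2 * q ^ (K + M + 1))) ^ K *
        (β * δ₁ * δ₂ * φ / (σ ^ 2 * q ^ (K + M + 1))) ^ M := by
      rw [← pow_add, ← pow_add, hN]
      ring
    have hZ : qPochs q [σ * q / (β * φ), σ * q / (δ₁ * φ), σ * q / (δ₂ * φ)] (K + M) /
          qPochs q [q, σ * q / φ, φ] (K + M) =
        (qPochs q [σ * q / β, σ * q / δ₁, σ * q / δ₂] (K + M) / qPochs q [σ * q, φ, q] (K + M)) *
        (qPochs q [σ * q, σ * q / (β * φ), σ * q / (δ₁ * φ), σ * q / (δ₂ * φ)]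
          (K + M) / qPochs q [σ * q / β, σ * q / φ, σ * q / δ₁, σ * q / δ₂] (K + M)) := by
      simp only [qPochs, List.map_cons, List.map_nil, List.prod_cons, List.prod_nil, mul_one]
      generalize qPoch q (σ * q / β) (K + M) = x1 at *
      generalize qPoch q (σ * q / δ₁) (K + M) = x2 at *
      generalize qPoch q (σ * q / δ₂) (K + M) = x3 at *
      generalize qPoch q (σ * q) (K + M) = x4 at *
      generalize qPoch q φ (K + M) = x5 at *
      generalize qPoch q q (K + M) = x6 at *
      generalize qPoch q (σ * q / φ) (K + M) = x7 at *
      generalize qPoch q (σ * q / (β * φ)) (K + M) = x8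
      generalize qPoch q (σ * q / (δ₁ * φ)) (K + M) = x9
      generalize qPoch q (σ * q / (δ₂ * φ)) (K + M) = x10
      field_simp
    rw [hZ] at hX
    refine mul_right_cancel₀ (mul_ne_zero hΩ0 hpl) ?_
    clear key hY hs hsq hqq hZ hΩ a1 a2 a3 a4 a5 a6
    generalize β * δ₁ * δ₂ * φ / (σ ^ 2 * q ^ (K + M + 1)) = A at *
    generalize q ^ (K * (K + M)) / q ^ K = pK at *
    generalize q ^ (M * (K + M)) / q ^ M = pM at *
    generalize q ^ ((K + j) * (K + M)) / q ^ (K + j) = pl at *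
    generalize qPochs q [σ * q / β, σ * q / δ₁, σ * q / δ₂] (K + M) /
      qPochs q [σ * q, φ, q] (K + M) = Z at *
    generalize qPochs q [σ * q, σ * q / (β * φ), σ * q / (δ₁ * φ), σ * q / (δ₂ * φ)] (K + M) /
      qPochs q [σ * q / β, σ * q / φ, σ * q / δ₁, σ * q / δ₂] (K + M) = C at *
    generalize qPochs q [(q ^ (K + M))⁻¹ * φ / σ, φ, (q ^ (K + M))⁻¹] (K + j) /
        qPochs q [(q ^ (K + M))⁻¹ * φ * β / σ, (q ^ (K + M))⁻¹ * δ₁ * φ / σ,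
          (q ^ (K + M))⁻¹ * δ₂ * φ / σ] (K + j) * q ^ (K + j) = G at *
    generalize qPochs q [σ * q / (β * φ), σ * q / (δ₁ * φ), σ * q / (δ₂ * φ)] L /
      qPochs q [q, σ * q / φ, q / (φ * q ^ (K + M))] L = X at *
    generalize revFactor q (K + M) 0 = Ω at *
    generalize binomCoeff q A j = B
    linear_combination B * A ^ L * hX + B * G * φ ^ (K + M) * Z * C * pl * hA -
      B * G * φ ^ (K + M) * Z * C * pl * A ^ K * A ^ M * hpp
  rw [sum_congr rfl hterm, ← mul_sum] at key
  -- The factor common to both sides; $(\varphi)_N$ in its denominator is the reason for the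
  -- genericity assumption on $\varphi$.
  have hne : qPochs q [σ * q / β, σ * q / δ₁, σ * q / δ₂] (K + M) /
      qPochs q [σ * q, φ, q] (K + M) * (revFactor q (K + M) 0 *
      (q ^ (K * (K + M)) / q ^ K) * (β * δ₁ * δ₂ * φ / (σ ^ 2 * q ^ 2)) ^ M) ≠ 0 := by
    rw [hY]
    refine mul_ne_zero (div_ne_zero ?_ ?_) (mul_ne_zero (mul_ne_zero hΩ0
      (div_ne_zero (pow_ne_zero _ hq) (pow_ne_zero _ hq))) (mul_ne_zero (pow_ne_zero _ hB0)
        (div_ne_zero (pow_ne_zero _ hq) (pow_ne_zero _ hq))))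
    · simp [qPochs, h1, h2, h3]
    · simp [qPochs, hsq, hφ1, hqq]
  refine mul_left_cancel₀ hne ?_
  linear_combination key

/-! ### Removal of the genericity of $\varphi$ by continuity -/

theorem continuous_qPoch (q : ℂ) (k : ℕ) : Continuous fun a => qPoch q a k := by
  unfold qPoch
  fun_prop

theorem ContinuousAt.qPoch {q : ℂ} {g : ℂ → ℂ} {x : ℂ} (hg : ContinuousAt g x) (k : ℕ) :
    ContinuousAt (fun y => qPoch q (g y) k) x :=
  (continuous_qPoch q k).continuousAt.comp hg

theorem ContinuousAt.qPochs_nil {q x : ℂ} {k : ℕ} : ContinuousAt (fun _ => qPochs q [] k) x :=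
  continuousAt_const

theorem ContinuousAt.qPochs_cons {q x : ℂ} {k : ℕ} {g : ℂ → ℂ} {l : ℂ → List ℂ}
    (hg : ContinuousAt g x) (hl : ContinuousAt (fun y => qPochs q (l y) k) x) :
    ContinuousAt (fun y => qPochs q (g y :: l y) k) x := by
  simp only [qPochs, List.map_cons, List.prod_cons] at hl ⊢
  exact (hg.qPoch k).mul hl

theorem continuousAt_sum {ι : Type*} {s : Finset ι} {g : ι → ℂ → ℂ} {x : ℂ}
    (h : ∀ i ∈ s, ContinuousAt (g i) x) : ContinuousAt (fun y => ∑ i ∈ s, g i y) x :=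
  tendsto_finsetSum s h

theorem qPoch_shift_ne_zero {q a : ℂ} {N K k : ℕ} (h : qPoch q a N ≠ 0) (hk : K + k ≤ N) :
    qPoch q (a * q ^ K) k ≠ 0 := by
  refine qPoch_ne_zero_iff.2 fun j hj => ?_
  have := qPoch_ne_zero_iff.1 h (K + j) (by omega)
  rwa [pow_add, ← mul_assoc] at this

/-- The zeros are finite in number, so a punctured neighbourhood avoids them even when $x$ is one of
them. -/
theorem eventually_qPoch_ne_zero {q : ℂ} (hq : q ≠ 0) (x : ℂ) (N : ℕ) :
    ∀ᶠ y in 𝓝[≠] x, qPoch q y N ≠ 0 := by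
  have hfin : ((((range N).image fun j => (q ^ j)⁻¹).erase x : Finset ℂ) : Set ℂ)ᶜ ∈ 𝓝 x :=
    (Finset.finite_toSet _).isClosed.isOpen_compl.mem_nhds (by simp)
  filter_upwards [nhdsWithin_le_nhds hfin, self_mem_nhdsWithin] with y hy hyx
  refine qPoch_ne_zero_iff.2 fun j hj h => hy ?_
  have := pow_ne_zero j hq
  simp only [coe_erase, coe_image, coe_range, Set.mem_sdiff, Set.mem_image, Set.mem_Iio,
    Set.mem_singleton_iff]
  refine ⟨⟨j, hj, ?_⟩, hyx⟩
  field_simp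
  linear_combination h

/-- Watson's transformation for the `₈W₇` series with base `σ q^K`. -/
theorem watson_shifted {q σ φ β δ₁ δ₂ : ℂ} {K M : ℕ} (hq : q ≠ 0) (hσ : σ ≠ 0) (hφ : φ ≠ 0)
    (hβ : β ≠ 0) (hδ₁ : δ₁ ≠ 0) (hδ₂ : δ₂ ≠ 0) (hqq : qPoch q q (K + M) ≠ 0)
    (hs : qPoch q σ (2 * (K + M) + 1) ≠ 0)
    (h1 : qPoch q (σ * q / β) (K + M) ≠ 0) (h2 : qPoch q (σ * q / δ₁) (K + M) ≠ 0)
    (h3 : qPoch q (σ * q / δ₂) (K + M) ≠ 0) (h4 : qPoch q (σ * q / φ) (K + M) ≠ 0)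
    (h5 : qPoch q (σ * q / (β * φ)) (K + M) ≠ 0) (h6 : qPoch q (σ * q / (δ₁ * φ)) (K + M) ≠ 0)
    (h7 : qPoch q (σ * q / (δ₂ * φ)) (K + M) ≠ 0) :
    qPochs q [σ * q, φ, (q ^ (K + M))⁻¹] K / qPochs q [σ * q / β, σ * q / δ₁, σ * q / δ₂] K *
        q ^ K * vwpSeries q (σ * q ^ K) [β, δ₁, δ₂, φ * q ^ K, (q ^ M)⁻¹]
          (σ ^ 2 * q ^ (K + M + 2) / (β * δ₁ * δ₂ * φ)) =
      φ ^ (K + M) * (qPochs q [σ * q, σ * q / (β * φ), σ * q / (δ₁ * φ), σ * q / (δ₂ * φ)] (K + M) /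
        qPochs q [σ * q / β, σ * q / φ, σ * q / δ₁, σ * q / δ₂] (K + M)) *
      ((β * δ₁ * δ₂ * φ / (σ ^ 2 * q ^ (K + M + 1))) ^ K * ∑ p ∈ antidiagonal M,
        binomCoeff q (β * δ₁ * δ₂ * φ / (σ ^ 2 * q ^ (K + M + 1))) p.1 *
        (qPochs q [(q ^ (K + M))⁻¹ * φ / σ, φ, (q ^ (K + M))⁻¹] (K + p.1) /
        qPochs q [(q ^ (K + M))⁻¹ * φ * β / σ, (q ^ (K + M))⁻¹ * δ₁ * φ / σ,
          (q ^ (K + M))⁻¹ * δ₂ * φ / σ] (K + p.1) * q ^ (K + p.1))) := by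
  have hσq : σ * q ≠ 0 := mul_ne_zero hσ hq
  have hQ : q ^ (K + M) ≠ 0 := pow_ne_zero _ hq
  have hprod (x : ℂ) (hx : x ≠ 0) : x * φ ≠ 0 := mul_ne_zero hx hφ
  have hev (g : ℂ → ℂ) (hg : ContinuousAt g φ) (h : qPoch q (g φ) (K + M) ≠ 0) :
      ∀ᶠ y in 𝓝[≠] φ, qPoch q (g y) (K + M) ≠ 0 :=
    ((hg.qPoch _).eventually_ne h).filter_mono nhdsWithin_le_nhds
  -- In the final identity $(\varphi)_k$ occurs in numerators only, so both sides are continuous at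
  -- $\varphi$ even where $(\varphi)_N=0$.
  refine tendsto_nhds_unique_of_eventuallyEq (l := 𝓝[≠] φ)
    (f := fun φ => qPochs q [σ * q, φ, (q ^ (K + M))⁻¹] K /
      qPochs q [σ * q / β, σ * q / δ₁, σ * q / δ₂] K *
        q ^ K * vwpSeries q (σ * q ^ K) [β, δ₁, δ₂, φ * q ^ K, (q ^ M)⁻¹]
          (σ ^ 2 * q ^ (K + M + 2) / (β * δ₁ * δ₂ * φ)))
    (g := fun φ => φ ^ (K + M) *
      (qPochs q [σ * q, σ * q / (β * φ), σ * q / (δ₁ * φ), σ * q / (δ₂ * φ)] (K + M) /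
        qPochs q [σ * q / β, σ * q / φ, σ * q / δ₁, σ * q / δ₂] (K + M)) *
      ((β * δ₁ * δ₂ * φ / (σ ^ 2 * q ^ (K + M + 1))) ^ K * ∑ p ∈ antidiagonal M,
        binomCoeff q (β * δ₁ * δ₂ * φ / (σ ^ 2 * q ^ (K + M + 1))) p.1 *
        (qPochs q [(q ^ (K + M))⁻¹ * φ / σ, φ, (q ^ (K + M))⁻¹] (K + p.1) /
        qPochs q [(q ^ (K + M))⁻¹ * φ * β / σ, (q ^ (K + M))⁻¹ * δ₁ * φ / σ,
          (q ^ (K + M))⁻¹ * δ₂ * φ / σ] (K + p.1) * q ^ (K + p.1))))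
    (ContinuousAt.tendsto ?_ |>.mono_left nhdsWithin_le_nhds)
    (ContinuousAt.tendsto ?_ |>.mono_left nhdsWithin_le_nhds) ?_
  · have e (φ : ℂ) := vwpSeries_eq_sum hq (σ * q ^ K) (σ ^ 2 * q ^ (K + M + 2) / (β * δ₁ * δ₂ * φ))
      (l := [β, δ₁, δ₂, φ * q ^ K, (q ^ M)⁻¹]) (n := M) (by simp)
    simp only [e]
    refine ContinuousAt.fun_mul ?_ (continuousAt_sum fun k hk => ?_)
    · refine ContinuousAt.fun_mul (ContinuousAt.div_const ?_ _) continuousAt_const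
      refine .qPochs_cons ?_ (.qPochs_cons ?_ (.qPochs_cons ?_ .qPochs_nil))
      all_goals fun_prop
    · have hk' : k ≤ M := by have := mem_range.1 hk; omega
      refine ContinuousAt.fun_mul continuousAt_const (ContinuousAt.fun_mul ?_ ?_)
      rotate_left
      · have hd : β * δ₁ * δ₂ * φ ≠ 0 := by positivity
        fun_prop (disch := exact hd)
      refine ContinuousAt.div₀ ?_ ?_ ?_
      · refine .qPochs_cons ?_ (.qPochs_cons ?_ (.qPochs_cons ?_ (.qPochs_cons ?_
          (.qPochs_cons ?_ (.qPochs_cons ?_ .qPochs_nil)))))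
        all_goals fun_prop
      · have hd := mul_ne_zero hφ (pow_ne_zero K hq)
        simp only [List.map_cons, List.map_nil]
        refine .qPochs_cons ?_ (.qPochs_cons ?_ (.qPochs_cons ?_ (.qPochs_cons ?_
          (.qPochs_cons ?_ (.qPochs_cons ?_ .qPochs_nil)))))
        all_goals fun_prop (disch := exact hd)
      · have n0 := qPoch_ne_zero_mono hqq (show k ≤ K + M by omega)
        have n1 := qPoch_shift_ne_zero h1 (show K + k ≤ K + M by omega)
        have n2 := qPoch_shift_ne_zero h2 (show K + k ≤ K + M by omega)
        have n3 := qPoch_shift_ne_zero h3 (show K + k ≤ K + M by omega)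
        have n4 := qPoch_ne_zero_mono h4 (show k ≤ K + M by omega)
        have n5 := qPoch_shift_ne_zero hs (show K + M + 1 + k ≤ 2 * (K + M) + 1 by omega)
        have e1 (x : ℂ) : σ * q ^ K * q / x = σ * q / x * q ^ K := by ring
        have e2 : σ * q / (φ * q ^ K) * q ^ K = σ * q / φ := by
          have := pow_ne_zero K hq
          field_simp
        have e3 : σ * q / (q ^ M)⁻¹ * q ^ K = σ * q ^ (K + M + 1) := by
          have := pow_ne_zero M hq
          field_simp
          ring
        simp only [qPochs, List.map_cons, List.map_nil, List.prod_cons, List.prod_nil, mul_one,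
          e1, e2, e3]
        exact mul_ne_zero n0 (mul_ne_zero n1 (mul_ne_zero n2 (mul_ne_zero n3 (mul_ne_zero n4 n5))))
  · refine ContinuousAt.fun_mul (ContinuousAt.fun_mul (by fun_prop) (ContinuousAt.div₀ ?_ ?_ ?_))
      (ContinuousAt.fun_mul (by fun_prop) (continuousAt_sum fun p hp => ?_))
    · refine .qPochs_cons ?_ (.qPochs_cons ?_ (.qPochs_cons ?_ (.qPochs_cons ?_ .qPochs_nil)))
      all_goals fun_prop (disch := first | exact hprod _ hβ | exact hprod _ hδ₁ | exact hprod _ hδ₂)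
    · refine .qPochs_cons ?_ (.qPochs_cons ?_ (.qPochs_cons ?_ (.qPochs_cons ?_ .qPochs_nil)))
      all_goals fun_prop (disch := exact hφ)
    · simp [qPochs, h1, h2, h3, h4]
    · have hp' := mem_antidiagonal.1 hp
      refine ContinuousAt.fun_mul ?_ (ContinuousAt.fun_mul (ContinuousAt.div₀ ?_ ?_ ?_) (by fun_prop))
      · have := continuous_qPoch q p.1
        unfold binomCoeff
        fun_prop
      · refine .qPochs_cons ?_ (.qPochs_cons ?_ (.qPochs_cons ?_ .qPochs_nil))
        all_goals fun_prop
      · refine .qPochs_cons ?_ (.qPochs_cons ?_ (.qPochs_cons ?_ .qPochs_nil))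
        all_goals fun_prop
      -- These denominators are reversals of $(\sigma q/(x\varphi))_N$ and inherit its nonvanishing.
      · have r (x z : ℂ) (hx : x ≠ 0) (hz : z = (q ^ (K + M))⁻¹ * x * φ / σ)
            (h : qPoch q (σ * q / (x * φ)) (K + M) ≠ 0) : qPoch q z (K + p.1) ≠ 0 := by
          have hN : K + M = p.2 + (K + p.1) := by omega
          rw [hN] at h hQ hz
          refine qPoch_reverse_ne_zero (m := p.2) hq (div_ne_zero hσq (hprod x hx)) ?_ h
          rw [hz]
          field_simp
        have r1 := r β ((q ^ (K + M))⁻¹ * φ * β / σ) hβ (by ring) h5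
        have r2 := r δ₁ _ hδ₁ rfl h6
        have r3 := r δ₂ _ hδ₂ rfl h7
        simp [qPochs, r1, r2, r3]
  · filter_upwards [eventually_qPoch_ne_zero hq φ (K + M),
      (eventually_ne_nhds hφ).filter_mono nhdsWithin_le_nhds,
      hev (fun y => σ * q / y) (by fun_prop (disch := assumption)) h4,
      hev (fun y => σ * q / (β * y)) (by fun_prop (disch := exact hprod _ hβ)) h5,
      hev (fun y => σ * q / (δ₁ * y)) (by fun_prop (disch := exact hprod _ hδ₁)) h6,
      hev (fun y => σ * q / (δ₂ * y)) (by fun_prop (disch := exact hprod _ hδ₂)) h7]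
      with y hy0 hy hy4 hy5 hy6 hy7
    exact watson_shifted_of_ne hq hσ hy hβ hδ₁ hδ₂ hqq hs hy0 h1 h2 h3 hy4 hy5 hy6 hy7

/-! ### Exchange of summations and the theorem -/

theorem a2Sum_swap (q t e f b c d d' : ℂ) (K : ℕ) :
    a2Sum q t e f b c d d' K = a2Sum q t e f c b d d' K := by
  simp only [a2Sum, mul_comm (a2Num q t c _ _) (a2Num q t b _ _)]

/-- Summation over the triangle $K+j\le N$, regrouped by $l=K+j$. -/
theorem sum_range_mul_sum_antidiagonal (g h w : ℕ → ℂ) (N : ℕ) :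
    ∑ K ∈ range (N + 1), g K * ∑ p ∈ antidiagonal (N - K), h p.1 * w (K + p.1) =
      ∑ l ∈ range (N + 1), w l * ∑ p ∈ antidiagonal l, h p.1 * g p.2 := by
  have key := Finset.sum_range_diag_flip (N + 1) fun K j => g K * (h j * w (K + j))
  rw [sum_congr rfl fun K hK => ?_, ← key]
  · refine sum_congr rfl fun l _ => ?_
    rw [← Nat.sum_antidiagonal_swap, Nat.sum_antidiagonal_eq_sum_range_succ_mk, mul_sum]
    refine sum_congr rfl fun k hk => ?_
    have : k + (l - k) = l := by have := mem_range.1 hk; omega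
    simp only [Prod.fst_swap, Prod.snd_swap, this]
    ring
  · have := mem_range.1 hK
    rw [Nat.sum_antidiagonal_eq_sum_range_succ_mk, mul_sum,
      show (N - K).succ = N + 1 - K by omega]

theorem mainTheorem4 (q : ℂ) (hq0 : 0 < ‖q‖) (hq1 : ‖q‖ < 1) (N : ℕ)
    (t σ b c d₁ d₂ e f β δ₁ δ₂ φ : ℂ)
    (ht : t ≠ 0) (hσ : σ ≠ 0)
    -- the totally balancing condition
    (hbal : t ^ 3 * σ ^ 2 * q ^ (N + 3) = (b * c * d₁ * d₂ * e * f) * (β * δ₁ * δ₂ * φ))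
    -- no denominator vanishes
    (hden₁ : ∀ x ∈ [b / t, c / t, d₁ / t, d₂ / t, q / e, q / f, t * q, t * q / e, t * q / f,
        t * q / (b * f), t * q / (c * f), t * q / (d₁ * f), t * q / (d₂ * f), f * q / e,
        σ * q / β, σ * q / δ₁, σ * q / δ₂, σ * q / φ,
        σ * q / (β * φ), σ * q / (δ₁ * φ), σ * q / (δ₂ * φ)], qPoch q x N ≠ 0)
    (hden₂ : qPoch q (1 / t) (N + 1) ≠ 0)
    (hden₃ : qPoch q (e / f) (N + 1) ≠ 0)
    (hden₄ : qPoch q σ (2 * N + 1) ≠ 0) :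
    ∑' K : ℕ,
      qPochs q [b / t, c / t, d₁ / t, d₂ / t, σ * q, φ, q ^ (-(N : ℤ))] K /
        qPochs q [q, 1 / t, q / e, q / f, σ * q / β, σ * q / δ₁, σ * q / δ₂] K * q ^ K *
      vwpSeries q (t * q ^ (-(K : ℤ)))
        [b, c, d₁, d₂, e * q ^ (-(K : ℤ)), f * q ^ (-(K : ℤ)), q ^ (-(K : ℤ))]
        (t ^ 3 * q ^ 3 / (b * c * d₁ * d₂ * e * f)) *
      vwpSeries q (σ * q ^ K)
        [β, δ₁, δ₂, φ * q ^ K, q ^ ((K : ℤ) - (N : ℤ))]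
        (σ ^ 2 * q ^ (N + 2) / (β * δ₁ * δ₂ * φ)) =
    φ ^ N *
      (qPochs q [σ * q, σ * q / (β * φ), σ * q / (δ₁ * φ), σ * q / (δ₂ * φ)] N /
        qPochs q [σ * q / β, σ * q / φ, σ * q / δ₁, σ * q / δ₂] N) *
      ∑' L : ℕ,
        qPochs q [t * q / (b * f), t * q / (c * f), t * q / (d₁ * f), t * q / (d₂ * f),
            q ^ (-(N : ℤ)) * φ / σ, φ, q ^ (-(N : ℤ))] L /
          qPochs q [q, e / f, t * q / f, q / f, q ^ (-(N : ℤ)) * φ * β / σ,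
            q ^ (-(N : ℤ)) * δ₁ * φ / σ, q ^ (-(N : ℤ)) * δ₂ * φ / σ] L * q ^ L *
        vwpSeries q (f * q ^ (-(L : ℤ)) / e)
          [t * q / (c * e), t * q / (b * e), t * q / (d₁ * e), t * q / (d₂ * e),
            f * q ^ (-(L : ℤ)) / t, f * q ^ (-(L : ℤ)), q ^ (-(L : ℤ))]
          (b * c * d₁ * d₂ * e * f * q ^ (-1 : ℤ) / t ^ 3) := by
  have hq : q ≠ 0 := norm_pos_iff.1 hq0
  have hN : q ^ N ≠ 0 := pow_ne_zero _ hq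
  have hqq (n : ℕ) : qPoch q q n ≠ 0 := by
    refine qPoch_ne_zero_iff.2 fun j _ h => ?_
    have h1 : ‖q ^ (j + 1)‖ < 1 := by
      rw [norm_pow]
      exact pow_lt_one₀ hq0.le hq1 (by omega)
    rw [show q ^ (j + 1) = 1 by rw [pow_succ']; linear_combination -h, norm_one] at h1
    exact lt_irrefl _ h1
  -- The balancing condition itself forces all remaining parameters to be nonzero.
  have hne : (b * c * d₁ * d₂ * e * f) * (β * δ₁ * δ₂ * φ) ≠ 0 := by
    rw [← hbal]
    positivity
  simp only [mul_ne_zero_iff] at hne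
  obtain ⟨⟨⟨⟨⟨⟨hb, hc⟩, hd₁⟩, hd₂⟩, he⟩, hf⟩, ⟨⟨hβ, hδ₁⟩, hδ₂⟩, hφ⟩ := hne
  simp only [List.mem_cons, List.not_mem_nil, or_false, forall_eq_or_imp, forall_eq] at hden₁
  obtain ⟨nb, nc, nd₁, nd₂, nqe, nqf, ntq, nte, ntf, nbf, ncf, nd₁f, nd₂f, nfe, nβ, nδ₁, nδ₂, nφ,
    nβφ, nδ₁φ, nδ₂φ⟩ := hden₁
  have hreg : A2Regular q t e f N :=
    ⟨hq, ht, he, hf, hqq N, hden₂, ntq, hden₃, nfe, nqe, nqf, nte, ntf⟩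
  -- The balancing condition in the form that is used: Watson's binomial parameter is the inverse of
  -- the Euler argument.
  have hA : (eulerArg q t e f b c d₁ d₂)⁻¹ = β * δ₁ * δ₂ * φ / (σ ^ 2 * q ^ (N + 1)) := by
    rw [inv_eq_iff_eq_inv, inv_div, eulerArg, mul_div_assoc', div_eq_div_iff (by positivity)
      (by positivity)]
    rw [pow_add] at hbal ⊢
    linear_combination -hbal
  have hzpow (n : ℕ) : q ^ (-(n : ℤ)) = (q ^ n)⁻¹ := by rw [zpow_neg, zpow_natCast]
  simp only [hzpow]
  set C := φ ^ N *
      (qPochs q [σ * q, σ * q / (β * φ), σ * q / (δ₁ * φ), σ * q / (δ₂ * φ)] N /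
        qPochs q [σ * q / β, σ * q / φ, σ * q / δ₁, σ * q / δ₂] N) with hC
  set A := β * δ₁ * δ₂ * φ / (σ ^ 2 * q ^ (N + 1)) with hA'
  set G : ℕ → ℂ := fun l => qPochs q [(q ^ N)⁻¹ * φ / σ, φ, (q ^ N)⁻¹] l /
    qPochs q [(q ^ N)⁻¹ * φ * β / σ, (q ^ N)⁻¹ * δ₁ * φ / σ, (q ^ N)⁻¹ * δ₂ * φ / σ] l * q ^ l
    with hG
  rw [tsum_eq_sum (s := range (N + 1)), tsum_eq_sum (s := range (N + 1))]
  · refine (sum_congr rfl (g := fun K => C * (A ^ K * a2Sum q t e f b c d₁ d₂ K *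
        ∑ p ∈ antidiagonal (N - K), binomCoeff q A p.1 * G (K + p.1))) fun K hK => ?_).trans
      (Eq.trans ?_ (congrArg (C * ·) (sum_congr rfl (g := fun L => G L * ∑ p ∈ antidiagonal L,
        binomCoeff q A p.1 * (A ^ p.2 * a2Sum q t e f b c d₁ d₂ p.2)) fun L hL => ?_)).symm)
    · obtain ⟨M, hM⟩ : ∃ M, N = K + M := ⟨N - K, by have := mem_range.1 hK; omega⟩
      have hKN : K ≤ N := by omega
      have h1 := vwpSeries_eq_a2Sum (hreg.mono hKN) hb hc hd₁ hd₂ (qPoch_ne_zero_mono nb hKN)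
        (qPoch_ne_zero_mono nc hKN) (qPoch_ne_zero_mono nd₁ hKN) (qPoch_ne_zero_mono nd₂ hKN)
      have h2 := watson_shifted (K := K) (M := M) hq hσ hφ hβ hδ₁ hδ₂ (hM ▸ hqq N) (hM ▸ hden₄)
        (hM ▸ nβ) (hM ▸ nδ₁) (hM ▸ nδ₂) (hM ▸ nφ) (hM ▸ nβφ) (hM ▸ nδ₁φ) (hM ▸ nδ₂φ)
      rw [← hM, ← hC, ← hA'] at h2
      have h3 : q ^ ((K : ℤ) - (N : ℤ)) = (q ^ M)⁻¹ := by
        rw [← hzpow, hM]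
        congr 1
        push_cast
        ring
      have h4 := congrArg₂ (fun x y : ℂ => x * y) h1 h2
      rw [show N - K = M by omega, h3]
      refine Eq.trans ?_ (h4.trans ?_)
      · simp only [qPochs, List.map_cons, List.map_nil, List.prod_cons, List.prod_nil, mul_one]
        generalize vwpSeries _ _ _ _ = V₁
        generalize vwpSeries _ _ _ _ = V₂
        ring
      · simp only [hG]
        ring
    · rw [← mul_sum,
        sum_range_mul_sum_antidiagonal (fun K => A ^ K * a2Sum q t e f b c d₁ d₂ K)]
    · have hLN : L ≤ N := by have := mem_range.1 hL; omega
      have h1 := a2Sum_dual_eq_sum (hreg.mono hLN) hb hc hd₁ hd₂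
      rw [hA] at h1
      -- The right-hand ₁₀W₉ lists $tq/(ce)$ before $tq/(be)$.
      rw [← h1, a2Sum_swap]
      have nz (x : ℂ) (hx : x ≠ 0) : t * q / (x * e) ≠ 0 := by positivity
      have hx (x : ℂ) (hx : x ≠ 0) : t * q / (x * e) / (f / e) = t * q / (x * f) := by field_simp
      have h2 := vwpSeries_eq_a2Sum (hreg.mono hLN).dual (nz c hc) (nz b hb) (nz d₁ hd₁)
        (nz d₂ hd₂) (by rw [hx c hc]; exact qPoch_ne_zero_mono ncf hLN)
        (by rw [hx b hb]; exact qPoch_ne_zero_mono nbf hLN)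
        (by rw [hx d₁ hd₁]; exact qPoch_ne_zero_mono nd₁f hLN)
        (by rw [hx d₂ hd₂]; exact qPoch_ne_zero_mono nd₂f hLN)
      have e1 : 1 / (f / e) = e / f := one_div_div f e
      have e2 : q / (f / t) = t * q / f := by field_simp
      have e3 : (f / e) ^ 3 * q ^ 3 / (t * q / (c * e) * (t * q / (b * e)) * (t * q / (d₁ * e)) *
          (t * q / (d₂ * e)) * (f / t) * f) = b * c * d₁ * d₂ * e * f * q ^ (-1 : ℤ) / t ^ 3 := by
        rw [zpow_neg_one]
        field_simp
      rw [← h2, hx b hb, hx c hc, hx d₁ hd₁, hx d₂ hd₂, e1, e2, e3, div_mul_eq_mul_div f e,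
        div_mul_eq_mul_div f t, hG]
      simp only [qPochs, List.map_cons, List.map_nil, List.prod_cons, List.prod_nil, mul_one]
      generalize vwpSeries _ _ _ _ = V
      ring
  · intro L hL
    rw [qPochs_eq_zero (x := (q ^ N)⁻¹) (by simp) (qPoch_inv_pow_eq_zero hq (by simpa using hL))]
    simp
  · intro K hK
    rw [qPochs_eq_zero (x := (q ^ N)⁻¹) (by simp) (qPoch_inv_pow_eq_zero hq (by simpa using hK))]
    simp
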